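/- Fix $0<\rho<1$. Let $\{\omega_x, I_{ie_1}, J_{je_2} : x\in\mathbb Z_{>0}^2,\ i,j\in\mathbb Z_{>0}\}$ be mutually independent random variables with $\omega_x\sim\mathrm{Exp}(1)$, $I_{ie_1}\sim\mathrm{Exp}(1-\rho)$ and $J_{je_2}\sim\mathrm{Exp}(\rho)$, where $\mathrm{Exp}(\lambda)$ is the exponential distribution with rate $\lambda$, and $e_1=(1,0)$, $e_2=(0,1)$. For $a\le b$ (coordinatewise) in $\mathbb Z_{>0}^2$ let $G_{a,b}=\max\sum_k\omega_{x_k}$, where the maximum is over the lattice paths $(x_k)$ from $a$ to $b$ with steps in $\{e_1,e_2\}$ and the sum includes both endpoints. For $m,n\ge1$ let $$G^\rho_{0,(m,n)}=\max_{1\le k\le m}\Bigl\{\sum_{i=1}^k I_{ie_1}+G_{(k,1),(m,n)}\Bigr\}\ \vee\ \max_{1\le \ell\le n}\Bigl\{\sum_{j=1}^\ell J_{je_2}+G_{(1,\ell),(m,n)}\Bigr\}$$ be the last-passage value of the stationary exponential corner growth model. For real $N\ge1$ let $\kappa_N=|m-N(1-\rho)^2|\vee|n-N\rho^2|$. (i)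 For every $a_0>0$ there is a constant $0<C=C(\rho,a_0)<\infty$ such that $G^\rho_{0,(m,n)}$ is square integrable and $$C^{-1}N^{2/3}\le \mathrm{Var}\bigl[G^\rho_{0,(m,n)}\bigr]\le C N^{2/3}$$ for all $(m,n)\in\mathbb Z_{>0}^2$ and all real $N\ge1$ with $\kappa_N\le a_0N^{2/3}$. (ii) The dependence on $a_0$ can be taken as follows: there are constants $c_1,C_2,C_3\in(0,\infty)$ that depend only on $\rho$ such that, for every $a_0>0$, $$c_1e^{-C_2a_0^3}N^{2/3}\le \mathrm{Var}\bigl[G^\rho_{0,(m,n)}\bigr]\le C_3(1+a_0)N^{2/3}$$ for all $(m,n)\in\mathbb Z_{>0}^2$ and all real $N\ge1$ with $\kappa_N\le a_0N^{2/3}$. -/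

import Mathlib

open MeasureTheory ProbabilityTheory

namespace CornerGrowth

/-- A single up-right step on the lattice: `y - x` is `e₁ = (1,0)` or `e₂ = (0,1)`. -/
def IsStep (x y : ℕ × ℕ) : Prop :=
  y = (x.1 + 1, x.2) ∨ y = (x.1, x.2 + 1)

/-- The set `Π_{a,b}` of up-right lattice paths from `a` to `b`; a path is the list of the
vertices that it visits, both endpoints included. -/
def upRightPaths (a b : ℕ × ℕ) : Set (List (ℕ × ℕ)) :=
  {p | p.IsChain IsStep ∧ p.head? = some a ∧ p.getLast? = some b}

/-- The last-passage value `G_{a,b} = max_{x ∈ Π_{a,b}} ∑_k w(x_k)` for `a ≤ b`. The supremum is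
over a finite nonempty set of reals, so it is a maximum (`lastPassage_isGreatest`). -/
noncomputable def lastPassage (w : ℕ × ℕ → ℝ) (a b : ℕ × ℕ) : ℝ :=
  sSup ((fun p : List (ℕ × ℕ) => (p.map w).sum) '' upRightPaths a b)

theorem upRightPaths_finite (a : ℕ × ℕ) :
    ∀ (s : ℕ) (b : ℕ × ℕ), b.1 + b.2 = s → (upRightPaths a b).Finite := by
  intro s
  induction s with
  | zero =>
    intro b hb
    apply (Set.finite_singleton [b]).subset
    rintro p ⟨h1, -, h3⟩
    obtain ⟨q, rfl⟩ := List.getLast?_eq_some_iff.1 h3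
    rcases List.eq_nil_or_concat q with rfl | ⟨q, c, rfl⟩
    · simp
    · exfalso
      have hs : IsStep c b := by
        rw [List.isChain_append] at h1
        exact h1.2.2 c (by simp) b (by simp)
      rcases hs with h | h <;> · rw [h] at hb; simp at hb
  | succ s ih =>
    intro b hb
    have hfin : (⋃ c ∈ {c : ℕ × ℕ | IsStep c b}, (upRightPaths a c)).Finite := by
      apply Set.Finite.biUnion
      · apply ((Set.finite_Iic b)).subset
        rintro c (h | h) <;> · rw [h]; simp [Prod.le_def]
      · rintro c (h | h) <;> · apply ih; rw [h] at hb; simp at hb; omega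
    apply ((hfin.image (fun q => q ++ [b])).union (Set.finite_singleton [b])).subset
    rintro p ⟨h1, h2, h3⟩
    obtain ⟨q, rfl⟩ := List.getLast?_eq_some_iff.1 h3
    rcases List.eq_nil_or_concat q with rfl | ⟨q, c, rfl⟩
    · simp
    · left
      rw [List.isChain_append] at h1
      have hs : IsStep c b := h1.2.2 c (by simp) b (by simp)
      refine ⟨_, Set.mem_biUnion hs ⟨h1.1, ?_, by simp⟩, rfl⟩
      cases q <;> simpa using h2

theorem upRightPaths_nonempty (a : ℕ × ℕ) (i j : ℕ) :
    (upRightPaths a (a.1 + i, a.2 + j)).Nonempty := by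
  have key : ∀ b c, (upRightPaths a b).Nonempty → IsStep b c → (upRightPaths a c).Nonempty := by
    rintro b c ⟨p, h1, h2, h3⟩ hs
    refine ⟨p ++ [c], ?_, ?_, by simp⟩
    · rw [List.isChain_append]
      refine ⟨h1, by simp, ?_⟩
      intro x hx y hy
      simp only [h3, Option.mem_some_iff, List.head?_cons] at hx hy
      rw [← hx, ← hy]; exact hs
    · rw [List.head?_append, h2]; rfl
  induction i with
  | zero =>
    induction j with
    | zero => exact ⟨[a], by simp [upRightPaths]⟩
    | succ j ih => exact key _ _ ih (Or.inr rfl)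
  | succ i ih => exact key _ _ ih (Or.inl rfl)

theorem lastPassage_isGreatest (w : ℕ × ℕ → ℝ) {a b : ℕ × ℕ} (hab : a ≤ b) :
    IsGreatest ((fun p : List (ℕ × ℕ) => (p.map w).sum) '' upRightPaths a b)
      (lastPassage w a b) := by
  have hf := (upRightPaths_finite a _ b rfl).image (fun p : List (ℕ × ℕ) => (p.map w).sum)
  have hne : (upRightPaths a b).Nonempty := by
    have h := upRightPaths_nonempty a (b.1 - a.1) (b.2 - a.2)
    rwa [Nat.add_sub_cancel' hab.1, Nat.add_sub_cancel' hab.2] at h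
  exact ⟨(hne.image _).csSup_mem hf, fun x hx => le_csSup hf.bddAbove hx⟩

/-- The last-passage value `G^ρ_{0,(m,n)}` with boundary weights `I_{i e₁} = w (i, 0)` and
`J_{j e₂} = w (0, j)` on the axes and bulk weights `w x`, `x ∈ ℤ_{>0}²`. The value `w (0, 0)` is
not used. -/
noncomputable def boundaryLastPassage (w : ℕ × ℕ → ℝ) : ℕ → ℕ → ℝ
  | m, 0 => ∑ i ∈ Finset.Icc 1 m, w (i, 0)
  | 0, n + 1 => ∑ j ∈ Finset.Icc 1 (n + 1), w (0, j)
  | m + 1, n + 1 =>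
    max
      ((Finset.Icc 1 (m + 1)).sup' ⟨1, by simp⟩ fun k =>
        (∑ i ∈ Finset.Icc 1 k, w (i, 0)) + lastPassage w (k, 1) (m + 1, n + 1))
      ((Finset.Icc 1 (n + 1)).sup' ⟨1, by simp⟩ fun l =>
        (∑ j ∈ Finset.Icc 1 l, w (0, j)) + lastPassage w (1, l) (m + 1, n + 1))

/-- The rate of the exponential weight at `x ≠ (0, 0)`: `1 - ρ` on the `e₁`-axis, `ρ` on the
`e₂`-axis and `1` in the bulk. -/
noncomputable def weightRate (ρ : ℝ) (x : ℕ × ℕ) : ℝ :=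
  if x.2 = 0 then 1 - ρ else if x.1 = 0 then ρ else 1

/-- The weights of the stationary exponential corner growth model with parameter `ρ`: mutually
independent variables indexed by the nonzero points `x` of the quadrant, exponentially distributed
with rate `1 - ρ` on the `e₁`-axis, `ρ` on the `e₂`-axis and `1` in the bulk. -/
structure IsStationaryWeights {Ω : Type*} [MeasurableSpace Ω] (ρ : ℝ) (P : Measure Ω)
    (w : ℕ × ℕ → Ω → ℝ) : Prop where
  hasLaw : ∀ x : ℕ × ℕ, x ≠ (0, 0) → HasLaw (w x) (expMeasure (weightRate ρ x)) P
  indep : iIndepFun (fun x : {x : ℕ × ℕ // x ≠ (0, 0)} => w x.1) P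

/-- The random variable `G^ρ_{0,(m,n)}` on `Ω`. -/
noncomputable def stationaryG {Ω : Type*} (w : ℕ × ℕ → Ω → ℝ) (m n : ℕ) : Ω → ℝ :=
  fun o => boundaryLastPassage (fun x => w x o) m n

/-- The deviation `κ_N` of `(m, n)` from the characteristic point `(N (1 - ρ)², N ρ²)`. -/
noncomputable def charDeviation (ρ N : ℝ) (m n : ℕ) : ℝ :=
  max |(m : ℝ) - N * (1 - ρ) ^ 2| |(n : ℝ) - N * ρ ^ 2|

end CornerGrowth

namespace CornerGrowth

/-! The variance bounds come from an exact moment generating function; no analysis of exit points is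
needed. Let `G^{z,w}` be the last-passage value with boundary rates `1 - z` on the `e₁`-axis and `w`
on the `e₂`-axis. Weighting the law by `exp ((w - z) ∑ J)` turns the `e₂`-rate `w` into `z`, so the
model becomes stationary. By the Burke property the increments along the top row are then
independent `Exp(1 - z)`, and tilting them gives `E exp ((w - z) G^{z,w}) = exp (L w - L z)` with `L
x = n log x - m log (1 - x)` (`lmarginal_exp_lpp`). The derivative of `L` at `ρ` is the mean of `G =
G^{ρ,ρ}`, the second derivative is the skew `m / (1 - ρ)² - n / ρ²`, and the remaining term is cubic
with coefficient of order `m + n`. The natural scale `s` therefore satisfies `s² |skew| + s³ (m + n)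
≍ 1`.

The formula says nothing directly about `G^{ρ,ρ}`, since there `w - z = 0`; three comparisons under
a coupling by scaling of the boundary weights transfer it. A path meets only one axis, so `G^{z,w} ≤
max (G^{z,z+t}, G^{w-t,w})`, which bounds positive exponential moments (`exp_coupledLpp_le`). The
value is a maximum of affine functions of the `e₂` scale, so convexity bounds `G` from below by
twice a value with a controlled negative exponential moment minus one with a controlled positive
exponential moment (`sq_le_of_convex`). Together these give the upper variance bound. Finally, `G`
dominates `G^{z,w}` for `z ≤ ρ ≤ w`, so `E exp (s (G - E G))` exceeds `1` by a fixed amount. As the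
linear term has mean zero and `E exp (2 s (G - E G))` is bounded, the variance cannot be smaller
than order `s⁻²` (`IsMomentScale.integral_sq_ge`).

Hence the variance is of order `(m + n)^{2/3} + |skew|`, uniformly in `(m, n)`. Both parts of the
theorem follow by comparing this quantity with `N^{2/3}`. -/

/-! ### Last-passage values through the recursion in the endpoint. -/

/-- The last-passage value with boundary weights, defined by its recursion in the endpoint. -/
noncomputable def lpp (X : ℕ × ℕ → ℝ) : ℕ → ℕ → ℝ
  | 0, n => ∑ j ∈ Finset.Icc 1 n, X (0, j)
  | m + 1, 0 => ∑ i ∈ Finset.Icc 1 (m + 1), X (i, 0)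
  | m + 1, n + 1 => X (m + 1, n + 1) + max (lpp X m (n + 1)) (lpp X (m + 1) n)

theorem lpp_zero_left (X : ℕ × ℕ → ℝ) (n : ℕ) :
    lpp X 0 n = ∑ j ∈ Finset.Icc 1 n, X (0, j) := by
  simp [lpp]

theorem lpp_zero_right (X : ℕ × ℕ → ℝ) (m : ℕ) :
    lpp X m 0 = ∑ i ∈ Finset.Icc 1 m, X (i, 0) := by
  cases m <;> simp [lpp]

theorem lpp_succ_succ (X : ℕ × ℕ → ℝ) (m n : ℕ) :
    lpp X (m + 1) (n + 1) = X (m + 1, n + 1) + max (lpp X m (n + 1)) (lpp X (m + 1) n) := by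
  simp [lpp]

theorem add_le_lpp_of_isStep (X : ℕ × ℕ → ℝ) {a b : ℕ × ℕ} (h : IsStep a b)
    (h1 : 1 ≤ a.1) (h2 : 1 ≤ a.2) : lpp X a.1 a.2 + X b ≤ lpp X b.1 b.2 := by
  obtain ⟨a1, a2⟩ := a
  obtain ⟨i, rfl⟩ : ∃ i, a1 = i + 1 := ⟨a1 - 1, by simp at h1; omega⟩
  obtain ⟨j, rfl⟩ : ∃ j, a2 = j + 1 := ⟨a2 - 1, by simp at h2; omega⟩
  rcases h with rfl | rfl
  · simp only [lpp_succ_succ X (i + 1) j]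
    linarith [le_max_left (lpp X (i + 1) (j + 1)) (lpp X (i + 1 + 1) j)]
  · simp only [lpp_succ_succ X i (j + 1)]
    linarith [le_max_right (lpp X i (j + 1 + 1)) (lpp X (i + 1) (j + 1))]

/-- Each step of a path in the bulk raises `lpp` by at least the new weight, so the inequality at
the starting point propagates to the end. The constant `c` stands for what has been collected
earlier, in the application on the axis. -/
theorem add_sum_le_lpp (X : ℕ × ℕ → ℝ) (b : ℕ × ℕ) (q : List (ℕ × ℕ)) :
    ∀ (a : ℕ × ℕ) (c : ℝ), (a :: q).IsChain IsStep → (a :: q).getLast? = some b →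
      1 ≤ a.1 → 1 ≤ a.2 → c + X a ≤ lpp X a.1 a.2 →
      c + ((a :: q).map X).sum ≤ lpp X b.1 b.2 := by
  induction q with
  | nil =>
    intro a c _ hl _ _ h
    simp only [List.getLast?_singleton, Option.some.injEq] at hl
    subst hl
    simpa using h
  | cons d q ih =>
    intro a c hc hl h1 h2 h
    rw [List.isChain_cons_cons] at hc
    have hd := add_le_lpp_of_isStep X hc.1 h1 h2
    have := ih d (c + X a) hc.2 (by simpa using hl)
      (by rcases hc.1 with h | h <;> rw [h] <;> simp [h1])
      (by rcases hc.1 with h | h <;> rw [h] <;> simp [h2]) (by linarith)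
    simp only [List.map_cons, List.sum_cons] at this ⊢
    linarith

theorem add_lastPassage_le_lpp (X : ℕ × ℕ → ℝ) {a b : ℕ × ℕ} (hab : a ≤ b) {c : ℝ}
    (h1 : 1 ≤ a.1) (h2 : 1 ≤ a.2) (h : c + X a ≤ lpp X a.1 a.2) :
    c + lastPassage X a b ≤ lpp X b.1 b.2 := by
  obtain ⟨p, ⟨hc, hh, hl⟩, hp⟩ := (lastPassage_isGreatest X hab).1
  rw [← hp]
  cases p with
  | nil => simp at hh
  | cons d q =>
    simp only [List.head?_cons, Option.some.injEq] at hh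
    subst hh
    exact add_sum_le_lpp X b q d c hc hl h1 h2 h

theorem lastPassage_add_le (X : ℕ × ℕ → ℝ) {a b c : ℕ × ℕ} (hab : a ≤ b) (hbc : IsStep b c) :
    lastPassage X a b + X c ≤ lastPassage X a c := by
  have hac : a ≤ c := by
    refine hab.trans ?_
    rcases hbc with rfl | rfl <;> simp [Prod.le_def]
  obtain ⟨p, ⟨h1, h2, h3⟩, hp⟩ := (lastPassage_isGreatest X hab).1
  refine (lastPassage_isGreatest X hac).2 ⟨p ++ [c], ⟨?_, ?_, by simp⟩, by simp [← hp]⟩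
  · rw [List.isChain_append]
    refine ⟨h1, by simp, ?_⟩
    intro x hx y hy
    simp only [h3, Option.mem_some_iff, List.head?_cons] at hx hy
    rw [← hx, ← hy]; exact hbc
  · rw [List.head?_append, h2]; rfl

theorem le_lastPassage_self (X : ℕ × ℕ → ℝ) (a : ℕ × ℕ) : X a ≤ lastPassage X a a :=
  (lastPassage_isGreatest X le_rfl).2 ⟨[a], by simp [upRightPaths], by simp⟩

theorem horizontal_le_boundaryLastPassage (X : ℕ × ℕ → ℝ) {m n k : ℕ} (hk : 1 ≤ k)
    (hkm : k ≤ m + 1) :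
    (∑ i ∈ Finset.Icc 1 k, X (i, 0)) + lastPassage X (k, 1) (m + 1, n + 1) ≤
      boundaryLastPassage X (m + 1) (n + 1) := by
  rw [boundaryLastPassage]
  exact le_max_of_le_left (Finset.le_sup'
    (fun k => (∑ i ∈ Finset.Icc 1 k, X (i, 0)) + lastPassage X (k, 1) (m + 1, n + 1))
    (Finset.mem_Icc.2 ⟨hk, hkm⟩))

theorem vertical_le_boundaryLastPassage (X : ℕ × ℕ → ℝ) {m n l : ℕ} (hl : 1 ≤ l)
    (hln : l ≤ n + 1) :
    (∑ j ∈ Finset.Icc 1 l, X (0, j)) + lastPassage X (1, l) (m + 1, n + 1) ≤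
      boundaryLastPassage X (m + 1) (n + 1) := by
  rw [boundaryLastPassage]
  exact le_max_of_le_right (Finset.le_sup'
    (fun l => (∑ j ∈ Finset.Icc 1 l, X (0, j)) + lastPassage X (1, l) (m + 1, n + 1))
    (Finset.mem_Icc.2 ⟨hl, hln⟩))

theorem boundaryLastPassage_add_le (X : ℕ × ℕ → ℝ) {m n m' n' : ℕ}
    (h : IsStep (m + 1, n + 1) (m' + 1, n' + 1)) :
    boundaryLastPassage X (m + 1) (n + 1) + X (m' + 1, n' + 1) ≤
      boundaryLastPassage X (m' + 1) (n' + 1) := by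
  have hm : m ≤ m' := by rcases h with h | h <;> simp at h <;> omega
  have hn : n ≤ n' := by rcases h with h | h <;> simp at h <;> omega
  rw [← le_sub_iff_add_le, boundaryLastPassage]
  refine max_le (Finset.sup'_le _ _ fun k hk => ?_) (Finset.sup'_le _ _ fun l hl => ?_)
  · rw [Finset.mem_Icc] at hk
    have h1 := lastPassage_add_le X (a := (k, 1)) (by simp [Prod.le_def, hk.2]) h
    have h2 := horizontal_le_boundaryLastPassage X (n := n') hk.1 (hk.2.trans (by omega : _ ≤ m' + 1))
    linarith
  · rw [Finset.mem_Icc] at hl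
    have h1 := lastPassage_add_le X (a := (1, l)) (by simp [Prod.le_def, hl.2]) h
    have h2 := vertical_le_boundaryLastPassage X (m := m') hl.1 (hl.2.trans (by omega : _ ≤ n' + 1))
    linarith

/-- An optimal path for the recursion ends with a step from the left or from below. If that
neighbour is in the bulk, its path is extended by one step; if it lies on an axis, the path leaves
the axis at the last possible point. -/
theorem lpp_le_boundaryLastPassage (X : ℕ × ℕ → ℝ) :
    ∀ m n, lpp X m n ≤ boundaryLastPassage X m n
  | 0, 0 => by simp [lpp, boundaryLastPassage]
  | 0, n + 1 => by simp [lpp, boundaryLastPassage]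
  | m + 1, 0 => by simp [lpp, boundaryLastPassage]
  | m + 1, n + 1 => by
    rw [lpp_succ_succ, ← le_sub_iff_add_le']
    refine max_le ?_ ?_
    · cases m with
      | zero =>
        have h1 := vertical_le_boundaryLastPassage X (m := 0) (n := n) (l := n + 1)
          (by omega) le_rfl
        have h2 := le_lastPassage_self X (1, n + 1)
        rw [lpp_zero_left]
        linarith
      | succ m =>
        have h1 := boundaryLastPassage_add_le X (m := m) (n := n) (m' := m + 1) (n' := n)
          (Or.inl rfl)
        have h2 := lpp_le_boundaryLastPassage X (m + 1) (n + 1)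
        linarith
    · cases n with
      | zero =>
        have h1 := horizontal_le_boundaryLastPassage X (m := m) (n := 0) (k := m + 1)
          (by omega) le_rfl
        have h2 := le_lastPassage_self X (m + 1, 1)
        rw [lpp_zero_right]
        linarith
      | succ n =>
        have h1 := boundaryLastPassage_add_le X (m := m) (n := n) (m' := m) (n' := n + 1)
          (Or.inr rfl)
        have h2 := lpp_le_boundaryLastPassage X (m + 1) (n + 1)
        linarith
  termination_by m n => m + n

theorem boundaryLastPassage_eq_lpp (X : ℕ × ℕ → ℝ) (m n : ℕ) :
    boundaryLastPassage X m n = lpp X m n := by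
  refine le_antisymm ?_ (lpp_le_boundaryLastPassage X m n)
  match m, n with
  | m, 0 => rw [lpp_zero_right, boundaryLastPassage]
  | 0, n + 1 => rw [lpp_zero_left, boundaryLastPassage]
  | m + 1, n + 1 =>
    rw [boundaryLastPassage]
    refine max_le (Finset.sup'_le _ _ fun k hk => ?_) (Finset.sup'_le _ _ fun l hl => ?_)
    · obtain ⟨hk1, hk2⟩ := Finset.mem_Icc.1 hk
      refine add_lastPassage_le_lpp X (a := (k, 1)) (b := (m + 1, n + 1))
        (by simp [Prod.le_def, hk2]) hk1 le_rfl ?_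
      obtain ⟨k, rfl⟩ : ∃ i, k = i + 1 := ⟨k - 1, by omega⟩
      simp only
      rw [lpp_succ_succ X k 0, add_comm, ← lpp_zero_right]
      gcongr
      exact le_max_right _ _
    · obtain ⟨hl1, hl2⟩ := Finset.mem_Icc.1 hl
      refine add_lastPassage_le_lpp X (a := (1, l)) (b := (m + 1, n + 1))
        (by simp [Prod.le_def, hl2]) le_rfl hl1 ?_
      obtain ⟨l, rfl⟩ : ∃ i, l = i + 1 := ⟨l - 1, by omega⟩
      simp only
      rw [lpp_succ_succ X 0 l, add_comm, ← lpp_zero_left]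
      gcongr
      exact le_max_left _ _

@[fun_prop]
theorem measurable_lpp (m n : ℕ) : Measurable fun X : ℕ × ℕ → ℝ => lpp X m n := by
  induction m generalizing n with
  | zero => simp only [lpp_zero_left]; fun_prop
  | succ m ihm =>
    induction n with
    | zero => simp only [lpp_zero_right]; fun_prop
    | succ n ihn =>
      simp only [lpp_succ_succ]
      exact (measurable_pi_apply _).add ((ihm _).max ihn)

theorem lpp_congr {X Y : ℕ × ℕ → ℝ} (m n : ℕ)
    (h : ∀ x : ℕ × ℕ, x ≠ (0, 0) → x.1 ≤ m → x.2 ≤ n → X x = Y x) : lpp X m n = lpp Y m n := by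
  induction m generalizing n with
  | zero =>
    simp only [lpp_zero_left]
    refine Finset.sum_congr rfl fun j hj => ?_
    rw [Finset.mem_Icc] at hj
    exact h _ (by simp; omega) (by simp) (by simp; omega)
  | succ m ihm =>
    induction n with
    | zero =>
      simp only [lpp_zero_right]
      refine Finset.sum_congr rfl fun j hj => ?_
      rw [Finset.mem_Icc] at hj
      exact h _ (by simp; omega) (by simp; omega) (by simp)
    | succ n ihn =>
      rw [lpp_succ_succ, lpp_succ_succ, h (m + 1, n + 1) (by simp) le_rfl le_rfl,
        ihm (n + 1) fun x h0 h1 h2 => h x h0 (by omega) h2,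
        ihn fun x h0 h1 h2 => h x h0 h1 (by omega)]

/-! ### Dependence on the boundary scales. -/

/-- Multiply the weights on the `e₁`-axis by `u` and those on the `e₂`-axis by `v`. -/
noncomputable def scaleBoundary (u v : ℝ) (X : ℕ × ℕ → ℝ) : ℕ × ℕ → ℝ := fun x =>
  (if x.2 = 0 then u else if x.1 = 0 then v else 1) * X x

/-- A path collects weights on only one axis, so an optimal path for `(u, v)` has the same value
after the scale of the other axis is changed. -/
theorem lpp_scaleBoundary_le_max (X : ℕ × ℕ → ℝ) (u v u' v' : ℝ) (m n : ℕ) :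
    lpp (scaleBoundary u v X) m n ≤
      max (lpp (scaleBoundary u v' X) m n) (lpp (scaleBoundary u' v X) m n) := by
  induction m generalizing n with
  | zero =>
    refine le_max_of_le_right (le_of_eq ?_)
    simp only [lpp_zero_left]
    refine Finset.sum_congr rfl fun j hj => ?_
    have : j ≠ 0 := by rw [Finset.mem_Icc] at hj; omega
    simp [scaleBoundary, this]
  | succ m ihm =>
    induction n with
    | zero =>
      refine le_max_of_le_left (le_of_eq ?_)
      simp only [lpp_zero_right, scaleBoundary, if_true]
    | succ n ihn =>
      have h := ihm (n + 1)
      simp only [lpp_succ_succ, scaleBoundary, Nat.add_eq_zero_iff, one_ne_zero, and_false,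
        if_false, one_mul, ← max_add_add_left] at h ihn ⊢
      grind

/-- As a function of the `e₂` scale the value is a maximum over paths of affine functions, hence
convex; only the midpoint case is needed. -/
theorem lpp_scaleBoundary_convex (X : ℕ × ℕ → ℝ) (u v v' : ℝ) (m n : ℕ) :
    2 * lpp (scaleBoundary u ((v + v') / 2) X) m n ≤
      lpp (scaleBoundary u v X) m n + lpp (scaleBoundary u v' X) m n := by
  induction m generalizing n with
  | zero =>
    refine le_of_eq ?_
    simp only [lpp_zero_left, Finset.mul_sum, ← Finset.sum_add_distrib]
    refine Finset.sum_congr rfl fun j hj => ?_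
    have : j ≠ 0 := by rw [Finset.mem_Icc] at hj; omega
    simp only [scaleBoundary, this, if_true, if_false]
    ring
  | succ m ihm =>
    induction n with
    | zero =>
      refine le_of_eq ?_
      simp only [lpp_zero_right, scaleBoundary, if_true]
      ring
    | succ n ihn =>
      have h := ihm (n + 1)
      simp only [lpp_succ_succ, scaleBoundary, Nat.add_eq_zero_iff, one_ne_zero, and_false,
        if_false, one_mul] at h ihn ⊢
      grind

theorem lpp_mono {X Y : ℕ × ℕ → ℝ} (m n : ℕ)
    (h : ∀ x : ℕ × ℕ, x ≠ (0, 0) → X x ≤ Y x) : lpp X m n ≤ lpp Y m n := by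
  induction m generalizing n with
  | zero =>
    simp only [lpp_zero_left]
    refine Finset.sum_le_sum fun j hj => ?_
    rw [Finset.mem_Icc] at hj
    exact h _ (by simp; omega)
  | succ m ihm =>
    induction n with
    | zero =>
      simp only [lpp_zero_right]
      refine Finset.sum_le_sum fun j hj => ?_
      rw [Finset.mem_Icc] at hj
      exact h _ (by simp; omega)
    | succ n ihn =>
      rw [lpp_succ_succ, lpp_succ_succ]
      exact add_le_add (h _ (by simp)) (max_le_max (ihm _) ihn)

/-! ### The Burke property of a single cell. -/

theorem lintegral_expMeasure (a : ℝ) {f : ℝ → ENNReal} (hf : Measurable f) :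
    ∫⁻ x, f x ∂expMeasure a = ∫⁻ x, exponentialPDF a x * f x := by
  have hp : Measurable (gammaPDF 1 a) := (measurable_gammaPDFReal 1 a).ennreal_ofReal
  rw [expMeasure, gammaMeasure, lintegral_withDensity_eq_lintegral_mul _ hp hf]
  rfl

@[fun_prop]
theorem measurable_exponentialPDF (a : ℝ) : Measurable (exponentialPDF a) :=
  (measurable_exponentialPDFReal a).ennreal_ofReal

/-- This is the change of variables `d = x - y`, `t = min x y`, which preserves Lebesgue measure; it
is a composition of two translations. -/
theorem lintegral_lintegral_sub_min (F : ℝ → ℝ → ENNReal)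
    (hF : Measurable fun p : ℝ × ℝ => F p.1 p.2) :
    ∫⁻ x, ∫⁻ y, F x y = ∫⁻ d, ∫⁻ t, F (max d 0 + t) (max (-d) 0 + t) := by
  rw [lintegral_lintegral_swap (f := F) hF.aemeasurable]
  calc ∫⁻ y, ∫⁻ x, F x y = ∫⁻ y, ∫⁻ d, F (d + y) y := by
        refine lintegral_congr fun y => ?_
        rw [lintegral_add_right_eq_self (fun x => F x y) y]
    _ = ∫⁻ d, ∫⁻ y, F (d + y) y := by
        rw [lintegral_lintegral_swap (f := fun y d => F (d + y) y)]
        exact (hF.comp (by fun_prop : Measurable fun p : ℝ × ℝ => (p.2 + p.1, p.1))).aemeasurable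
    _ = _ := by
        refine lintegral_congr fun d => ?_
        rw [← lintegral_add_right_eq_self (fun y => F (d + y) y) (max (-d) 0)]
        refine lintegral_congr fun t => ?_
        congr 1 <;> grind

/-- In the coordinates `d = x - y`, `t = min x y`, `s` the corner flip fixes `d` and exchanges `t`
with `s`, so it preserves volume. -/
theorem lintegral_burke_volume (h : ℝ → ℝ → ℝ → ENNReal)
    (hh : Measurable fun p : ℝ × ℝ × ℝ => h p.1 p.2.1 p.2.2) :
    ∫⁻ x, ∫⁻ y, ∫⁻ s, h (max (x - y) 0 + s) (max (y - x) 0 + s) (min x y) =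
      ∫⁻ x, ∫⁻ y, ∫⁻ s, h x y s := by
  have h1 : Measurable fun p : ℝ × ℝ => ∫⁻ s, h p.1 p.2 s :=
    Measurable.lintegral_prod_right' (f := fun q : (ℝ × ℝ) × ℝ => h q.1.1 q.1.2 q.2)
      (hh.comp (by fun_prop : Measurable fun q : (ℝ × ℝ) × ℝ => (q.1.1, q.1.2, q.2)))
  have h2 : Measurable fun p : ℝ × ℝ => ∫⁻ s, h (max (p.1 - p.2) 0 + s) (max (p.2 - p.1) 0 + s)
      (min p.1 p.2) :=
    Measurable.lintegral_prod_right' (f := fun q : (ℝ × ℝ) × ℝ =>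
      h (max (q.1.1 - q.1.2) 0 + q.2) (max (q.1.2 - q.1.1) 0 + q.2) (min q.1.1 q.1.2))
      (hh.comp (by fun_prop : Measurable fun q : (ℝ × ℝ) × ℝ =>
        (max (q.1.1 - q.1.2) 0 + q.2, max (q.1.2 - q.1.1) 0 + q.2, min q.1.1 q.1.2)))
  refine (lintegral_lintegral_sub_min _ h2).trans
    (Eq.trans ?_ (lintegral_lintegral_sub_min _ h1).symm)
  refine lintegral_congr fun d => ?_
  rw [lintegral_lintegral_swap (f := fun t s => h (max d 0 + t) (max (-d) 0 + t) s)]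
  · refine lintegral_congr fun t => lintegral_congr fun s => ?_
    congr 1 <;> grind
  · exact (hh.comp (by fun_prop : Measurable fun q : ℝ × ℝ =>
      (max d 0 + q.1, max (-d) 0 + q.1, q.2))).aemeasurable

/-- With `d = x - y` and `t = min x y`, the exponent `a x + b y + (a + b) s` equals `a d⁺ + b d⁻ +
(a + b) (t + s)`, which is symmetric in `t` and `s`. The flip also preserves the octant where the
densities are supported. -/
theorem exponentialPDF_burke {a b : ℝ} (ha : 0 < a) (hb : 0 < b) (x y s : ℝ) :
    exponentialPDF a (max (x - y) 0 + s) *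
      (exponentialPDF b (max (y - x) 0 + s) * exponentialPDF (a + b) (min x y)) =
    exponentialPDF a x * (exponentialPDF b y * exponentialPDF (a + b) s) := by
  by_cases h : 0 ≤ x ∧ 0 ≤ y ∧ 0 ≤ s
  · obtain ⟨hx, hy, hs⟩ := h
    rw [exponentialPDF_of_nonneg (by positivity), exponentialPDF_of_nonneg (by positivity),
      exponentialPDF_of_nonneg (le_min hx hy), exponentialPDF_of_nonneg hx,
      exponentialPDF_of_nonneg hy, exponentialPDF_of_nonneg hs]
    rw [← ENNReal.ofReal_mul (by positivity), ← ENNReal.ofReal_mul (by positivity),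
      ← ENNReal.ofReal_mul (by positivity), ← ENNReal.ofReal_mul (by positivity)]
    congr 1
    have key : ∀ A B C : ℝ, a * Real.exp A * (b * Real.exp B * ((a + b) * Real.exp C)) =
        a * b * (a + b) * Real.exp (A + B + C) := by
      intro A B C; rw [Real.exp_add, Real.exp_add]; ring
    rw [key, key]
    congr 2
    rcases le_total x y with hxy | hxy
    · rw [max_eq_right (by linarith), max_eq_left (by linarith), min_eq_left hxy]; ring
    · rw [max_eq_left (by linarith), max_eq_right (by linarith), min_eq_right hxy]; ring
  · have hR : exponentialPDF a x * (exponentialPDF b y * exponentialPDF (a + b) s) = 0 := by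
      by_cases hx : x < 0
      · simp [exponentialPDF_of_neg hx]
      by_cases hy : y < 0
      · simp [exponentialPDF_of_neg hy]
      have hs : s < 0 := by
        by_contra hs
        exact h ⟨by linarith, by linarith, by linarith⟩
      simp [exponentialPDF_of_neg hs]
    rw [hR]
    by_cases hm : min x y < 0
    · simp [exponentialPDF_of_neg hm]
    rw [not_lt, le_min_iff] at hm
    have hs : s < 0 := by
      by_contra hs
      exact h ⟨hm.1, hm.2, by linarith⟩
    rcases le_total x y with hxy | hxy
    · rw [exponentialPDF_of_neg (r := a) (by rw [max_eq_right (by linarith)]; linarith)]; simp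
    · rw [exponentialPDF_of_neg (r := b) (by rw [max_eq_right (by linarith)]; linarith)]; simp

theorem lintegral_lintegral_lintegral_expMeasure (a b c : ℝ) (g : ℝ → ℝ → ℝ → ENNReal)
    (hg : Measurable fun p : ℝ × ℝ × ℝ => g p.1 p.2.1 p.2.2) :
    ∫⁻ x, ∫⁻ y, ∫⁻ s, g x y s ∂expMeasure c ∂expMeasure b ∂expMeasure a =
      ∫⁻ x, ∫⁻ y, ∫⁻ s,
        exponentialPDF a x * (exponentialPDF b y * exponentialPDF c s) * g x y s := by
  have hg3 : ∀ x y, Measurable fun s => g x y s := fun x y =>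
    hg.comp (by fun_prop : Measurable fun s : ℝ => (x, y, s))
  have hm3 : Measurable fun q : (ℝ × ℝ) × ℝ => exponentialPDF c q.2 * g q.1.1 q.1.2 q.2 :=
    (by fun_prop : Measurable fun q : (ℝ × ℝ) × ℝ => exponentialPDF c q.2).mul
      (hg.comp (by fun_prop : Measurable fun q : (ℝ × ℝ) × ℝ => (q.1.1, q.1.2, q.2)))
  have hm2 : Measurable fun q : ℝ × ℝ => ∫⁻ s, exponentialPDF c s * g q.1 q.2 s :=
    hm3.lintegral_prod_right'
  have hm1 : Measurable fun x : ℝ => ∫⁻ y, exponentialPDF b y *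
      ∫⁻ s, exponentialPDF c s * g x y s :=
    Measurable.lintegral_prod_right' (f := fun q : ℝ × ℝ => exponentialPDF b q.2 *
      ∫⁻ s, exponentialPDF c s * g q.1 q.2 s)
      ((by fun_prop : Measurable fun q : ℝ × ℝ => exponentialPDF b q.2).mul hm2)
  have e3 : ∀ x y, ∫⁻ s, g x y s ∂expMeasure c = ∫⁻ s, exponentialPDF c s * g x y s :=
    fun x y => lintegral_expMeasure c (hg3 x y)
  simp only [e3]
  have hm2' : ∀ x, Measurable fun y => ∫⁻ s, exponentialPDF c s * g x y s := fun x =>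
    hm2.comp (by fun_prop : Measurable fun y : ℝ => (x, y))
  have e2 : ∀ x, ∫⁻ y, (∫⁻ s, exponentialPDF c s * g x y s) ∂expMeasure b =
      ∫⁻ y, exponentialPDF b y * ∫⁻ s, exponentialPDF c s * g x y s := fun x =>
    lintegral_expMeasure b (hm2' x)
  simp only [e2]
  rw [lintegral_expMeasure a hm1]
  refine lintegral_congr fun x => ?_
  rw [← lintegral_const_mul _ (by exact (measurable_exponentialPDF b).mul (hm2' x))]
  refine lintegral_congr fun y => ?_
  have h3 : Measurable fun s => exponentialPDF c s * g x y s :=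
    (measurable_exponentialPDF c).mul (hg3 x y)
  rw [← lintegral_const_mul _ h3, ← lintegral_const_mul _ (h3.const_mul _)]
  refine lintegral_congr fun s => ?_
  ring

/-- The corner flip preserves the product of the exponential laws of rates `a`, `b`, `a + b`. -/
theorem lintegral_burke {a b : ℝ} (ha : 0 < a) (hb : 0 < b) (g : ℝ → ℝ → ℝ → ENNReal)
    (hg : Measurable fun p : ℝ × ℝ × ℝ => g p.1 p.2.1 p.2.2) :
    ∫⁻ x, ∫⁻ y, ∫⁻ s, g (max (x - y) 0 + s) (max (y - x) 0 + s) (min x y)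
        ∂expMeasure (a + b) ∂expMeasure b ∂expMeasure a =
      ∫⁻ x, ∫⁻ y, ∫⁻ s, g x y s ∂expMeasure (a + b) ∂expMeasure b ∂expMeasure a := by
  rw [lintegral_lintegral_lintegral_expMeasure _ _ _ g hg,
    lintegral_lintegral_lintegral_expMeasure _ _ _ (fun x y s => g (max (x - y) 0 + s)
      (max (y - x) 0 + s) (min x y)) (hg.comp (by fun_prop : Measurable fun p : ℝ × ℝ × ℝ =>
        (max (p.1 - p.2.1) 0 + p.2.2, max (p.2.1 - p.1) 0 + p.2.2, min p.1 p.2.1)))]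
  rw [← lintegral_burke_volume (fun x y s =>
    exponentialPDF a x * (exponentialPDF b y * exponentialPDF (a + b) s) * g x y s)
    ((by fun_prop : Measurable fun p : ℝ × ℝ × ℝ => exponentialPDF a p.1 *
      (exponentialPDF b p.2.1 * exponentialPDF (a + b) p.2.2)).mul hg)]
  simp only [exponentialPDF_burke ha hb]

/-- The corner flip at a cell whose south, west and bulk weights are indexed by `α`, `β`, `γ`. -/
noncomputable def cornerFlip {ι : Type*} [DecidableEq ι] (α β γ : ι) (X : ι → ℝ) : ι → ℝ :=
  Function.update (Function.update (Function.update X α (max (X α - X β) 0 + X γ))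
    β (max (X β - X α) 0 + X γ)) γ (min (X α) (X β))

theorem measurable_update_update_update {ι : Type*} [DecidableEq ι] (α β γ : ι) :
    Measurable fun p : (ι → ℝ) × ℝ × ℝ × ℝ =>
      Function.update (Function.update (Function.update p.1 α p.2.1) β p.2.2.1) γ p.2.2.2 := by
  refine measurable_pi_iff.2 fun i => ?_
  simp only [Function.update_apply]
  split_ifs <;> fun_prop

theorem measurable_cornerFlip {ι : Type*} [DecidableEq ι] (α β γ : ι) :
    Measurable (cornerFlip α β γ) :=
  (measurable_update_update_update α β γ).comp
    (by fun_prop : Measurable fun X : ι → ℝ =>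
      (X, max (X α - X β) 0 + X γ, max (X β - X α) 0 + X γ, min (X α) (X β)))

theorem lmarginal_erase_three {ι : Type*} [DecidableEq ι] (μ : ι → Measure ℝ)
    [∀ i, SigmaFinite (μ i)] {S : Finset ι} {α β γ : ι} (hα : α ∈ S) (hβ : β ∈ S) (hγ : γ ∈ S)
    (hαβ : α ≠ β) (hαγ : α ≠ γ) (hβγ : β ≠ γ) {f : (ι → ℝ) → ENNReal} (hf : Measurable f) :
    lmarginal μ S f = lmarginal μ (((S.erase γ).erase β).erase α) fun X =>
      ∫⁻ x, ∫⁻ y, ∫⁻ s, f (Function.update (Function.update (Function.update X α x) β y) γ s)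
        ∂μ γ ∂μ β ∂μ α := by
  have h1 : Measurable fun X => ∫⁻ s, f (Function.update X γ s) ∂μ γ := by
    have := hf.lmarginal μ (s := {γ})
    rwa [lmarginal_singleton] at this
  have h2 : Measurable fun X => ∫⁻ y, ∫⁻ s, f (Function.update (Function.update X β y) γ s)
      ∂μ γ ∂μ β := by
    have := h1.lmarginal μ (s := {β})
    rwa [lmarginal_singleton] at this
  rw [lmarginal_erase' _ hf hγ, lmarginal_erase' _ h1 (i := β) (by simp [hβ, hβγ]),
    lmarginal_erase' _ h2 (i := α) (by simp [hα, hαβ, hαγ])]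

/-- The flip touches only three coordinates, so these are integrated out first and `lintegral_burke`
is applied with the others frozen. -/
theorem lmarginal_cornerFlip {ι : Type*} [DecidableEq ι] (r : ι → ℝ) (hr : ∀ i, 0 < r i)
    {S : Finset ι} {α β γ : ι} (hα : α ∈ S) (hβ : β ∈ S) (hγ : γ ∈ S)
    (hαβ : α ≠ β) (hαγ : α ≠ γ) (hβγ : β ≠ γ) (hrate : r γ = r α + r β)
    {f : (ι → ℝ) → ENNReal} (hf : Measurable f) :
    lmarginal (fun i => expMeasure (r i)) S (fun X => f (cornerFlip α β γ X)) =
      lmarginal (fun i => expMeasure (r i)) S f := by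
  have : ∀ i, IsProbabilityMeasure (expMeasure (r i)) := fun i =>
    isProbabilityMeasure_expMeasure (hr i)
  rw [lmarginal_erase_three _ hα hβ hγ hαβ hαγ hβγ hf]
  refine (lmarginal_erase_three _ hα hβ hγ hαβ hαγ hβγ
    (hf.comp (measurable_cornerFlip α β γ))).trans ?_
  congr 1
  funext X
  simp only [hrate]
  have := lintegral_burke (hr α) (hr β) (fun x y s =>
    f (Function.update (Function.update (Function.update X α x) β y) γ s))
    (hf.comp ((measurable_update_update_update α β γ).comp
      (by fun_prop : Measurable fun p : ℝ × ℝ × ℝ => (X, p))))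
  rw [← this]
  refine lintegral_congr fun x => lintegral_congr fun y => lintegral_congr fun s => ?_
  rw [Function.comp_apply]
  congr 1
  funext i
  simp only [cornerFlip, Function.update_apply]
  grind

/-! ### Exponential tilting and first moments. -/

/-- An exponential tilt by `t` only shifts the rate from `a` to `a - t`, up to the normalisation `a
/ (a - t)`. This is what turns one boundary parameter into another. -/
theorem lintegral_exp_mul_expMeasure {a t : ℝ} (ha : 0 < a) (hta : t < a) {h : ℝ → ENNReal}
    (hh : Measurable h) :
    ∫⁻ x, ENNReal.ofReal (Real.exp (t * x)) * h x ∂expMeasure a =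
      ENNReal.ofReal (a / (a - t)) * ∫⁻ x, h x ∂expMeasure (a - t) := by
  have hat : 0 < a - t := by linarith
  rw [lintegral_expMeasure a (by fun_prop), lintegral_expMeasure _ hh,
    ← lintegral_const_mul _ (by fun_prop)]
  refine lintegral_congr fun x => ?_
  rw [← mul_assoc, ← mul_assoc]
  congr 1
  rcases lt_or_ge x 0 with hx | hx
  · simp [exponentialPDF_of_neg hx]
  · rw [exponentialPDF_of_nonneg hx, exponentialPDF_of_nonneg hx,
      ← ENNReal.ofReal_mul (by positivity), ← ENNReal.ofReal_mul (by positivity)]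
    congr 1
    rw [mul_assoc, ← Real.exp_add, ← mul_assoc, div_mul_cancel₀ _ hat.ne']
    ring_nf

theorem ae_nonneg_expMeasure (a : ℝ) : ∀ᵐ x ∂expMeasure a, 0 ≤ x := by
  have h : expMeasure a (Set.Iio 0) = 0 := by
    rw [expMeasure, gammaMeasure, withDensity_apply _ measurableSet_Iio]
    exact lintegral_gammaPDF_of_nonpos le_rfl
  rw [ae_iff]
  simpa [Set.Iio] using h

theorem lintegral_abs_expMeasure {a : ℝ} (ha : 0 < a) :
    ∫⁻ x, ENNReal.ofReal |x| ∂expMeasure a = ENNReal.ofReal (1 / a) := by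
  have h1 : ∫ x in Set.Ioi (0 : ℝ), a * (x ^ (2 - 1 : ℝ) * Real.exp (-(a * x))) = 1 / a := by
    rw [integral_const_mul, Real.integral_rpow_mul_exp_neg_mul_Ioi (by norm_num) ha]
    rw [Real.Gamma_two]
    norm_cast
    field_simp
  rw [lintegral_expMeasure _ (by fun_prop), ← h1, ofReal_integral_eq_lintegral_ofReal]
  · rw [← lintegral_indicator measurableSet_Ioi]
    refine lintegral_congr fun x => ?_
    rcases lt_trichotomy x 0 with hx | hx | hx
    · simp [exponentialPDF_of_neg hx, hx.le]
    · simp [hx]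
    · rw [Set.indicator_of_mem (Set.mem_Ioi.2 hx), exponentialPDF_of_nonneg hx.le,
        ← ENNReal.ofReal_mul (by positivity), abs_of_pos hx]
      congr 1
      norm_num
      ring
  · refine Integrable.of_integral_ne_zero ?_
    rw [h1]
    positivity
  · filter_upwards [ae_restrict_mem measurableSet_Ioi] with x hx
    have hx' : (0 : ℝ) < x := hx
    simp only [Pi.zero_apply]
    positivity

theorem integrable_id_expMeasure {a : ℝ} (ha : 0 < a) :
    Integrable (fun x : ℝ => x) (expMeasure a) := by
  refine ⟨by fun_prop, ?_⟩
  rw [hasFiniteIntegral_iff_norm]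
  simp only [Real.norm_eq_abs]
  rw [lintegral_abs_expMeasure ha]
  exact ENNReal.ofReal_lt_top

theorem integral_id_expMeasure {a : ℝ} (ha : 0 < a) : ∫ x, x ∂expMeasure a = 1 / a := by
  rw [integral_eq_lintegral_of_nonneg_ae (ae_nonneg_expMeasure a) (by fun_prop),
    ← ENNReal.toReal_ofReal (by positivity : (0 : ℝ) ≤ 1 / a), ← lintegral_abs_expMeasure ha]
  congr 1
  refine lintegral_congr_ae ?_
  filter_upwards [ae_nonneg_expMeasure a] with x hx
  rw [abs_of_nonneg hx]

theorem map_mul_expMeasure {a c : ℝ} (ha : 0 < a) (hc : 0 < c) :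
    (expMeasure a).map (fun x => c * x) = expMeasure (a / c) := by
  have := isProbabilityMeasure_expMeasure ha
  have := isProbabilityMeasure_expMeasure (div_pos ha hc)
  have : IsProbabilityMeasure ((expMeasure a).map (fun x => c * x)) :=
    Measure.isProbabilityMeasure_map (by fun_prop)
  refine Measure.eq_of_cdf _ _ ?_
  ext x
  have h : cdf ((expMeasure a).map (fun x => c * x)) x = cdf (expMeasure a) (x / c) := by
    rw [cdf_eq_real, cdf_eq_real, map_measureReal_apply (by fun_prop) measurableSet_Iic]
    congr 1
    ext y
    simp only [Set.mem_preimage, Set.mem_Iic]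
    rw [le_div_iff₀' hc]
  rw [h, cdf_expMeasure_eq ha, cdf_expMeasure_eq (div_pos ha hc)]
  rw [mul_div_assoc', div_mul_eq_mul_div]
  congr 1
  rw [le_div_iff₀ hc, zero_mul]

theorem lmarginal_const_mul {ι : Type*} [DecidableEq ι] (μ : ι → Measure ℝ)
    [∀ i, SigmaFinite (μ i)] (s : Finset ι) {F : (ι → ℝ) → ENNReal} (hF : Measurable F)
    (c : ENNReal) :
    lmarginal μ s (fun X => c * F X) = fun X => c * lmarginal μ s F X := by
  funext X
  exact lintegral_const_mul _ (hF.comp measurable_updateFinset)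

/-- Product change of measure: if `f i` has density ratio `c i` between `μ i` and `μ' i`, then the
product of the `f i` changes the product of the `μ i` into that of the `μ' i`. -/
theorem lmarginal_prod_mul {ι : Type*} [DecidableEq ι] (μ μ' : ι → Measure ℝ)
    [∀ i, SigmaFinite (μ i)] [∀ i, SigmaFinite (μ' i)] {f : ι → ℝ → ENNReal}
    (hf : ∀ i, Measurable (f i)) (c : ι → ENNReal)
    (h : ∀ i (g : ℝ → ENNReal), Measurable g →
      ∫⁻ x, f i x * g x ∂μ i = c i * ∫⁻ x, g x ∂μ' i) (s : Finset ι) :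
    ∀ {F : (ι → ℝ) → ENNReal}, Measurable F →
      lmarginal μ s (fun X => (∏ i ∈ s, f i (X i)) * F X) =
        fun X => (∏ i ∈ s, c i) * lmarginal μ' s F X := by
  induction s using Finset.induction_on with
  | empty => intro F hF; simp
  | insert i s hi ih =>
    intro F hF
    have hmeas : Measurable fun X : ι → ℝ => (∏ k ∈ insert i s, f k (X k)) * F X := by
      refine Measurable.mul ?_ hF
      exact Finset.measurable_prod _ fun k _ => (hf k).comp (measurable_pi_apply k)
    have hF' : Measurable fun X => ∫⁻ x, F (Function.update X i x) ∂μ' i := by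
      have := hF.lmarginal μ' (s := {i})
      rwa [lmarginal_singleton] at this
    rw [lmarginal_insert' _ hmeas hi, lmarginal_insert' _ hF hi]
    have hstep : (fun X : ι → ℝ => ∫⁻ x, (∏ k ∈ insert i s, f k (Function.update X i x k)) *
        F (Function.update X i x) ∂μ i) = fun X => (∏ k ∈ s, f k (X k)) *
          (c i * ∫⁻ x, F (Function.update X i x) ∂μ' i) := by
      funext X
      have hFX : Measurable fun x => F (Function.update X i x) :=
        hF.comp (measurable_update X)
      rw [← h i _ hFX, ← lintegral_const_mul _ (by exact (hf i).mul hFX)]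
      refine lintegral_congr fun x => ?_
      rw [Finset.prod_insert hi, Function.update_self]
      have : ∏ k ∈ s, f k (Function.update X i x k) = ∏ k ∈ s, f k (X k) := by
        refine Finset.prod_congr rfl fun k hk => ?_
        rw [Function.update_of_ne (by rintro rfl; exact hi hk)]
      rw [this]
      ring
    rw [hstep, ih (hF'.const_mul _), lmarginal_const_mul _ _ hF', Finset.prod_insert hi]
    funext X
    ring

/-! ### Propagating corner flips through the rectangle. -/

/-- The rate `a` on the `e₁`-axis, `b` on the `e₂`-axis and `1` in the bulk. -/
noncomputable def boundaryRate (a b : ℝ) (x : ℕ × ℕ) : ℝ :=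
  if x.2 = 0 then a else if x.1 = 0 then b else 1

theorem boundaryRate_pos {a b : ℝ} (ha : 0 < a) (hb : 0 < b) (x : ℕ × ℕ) :
    0 < boundaryRate a b x := by
  unfold boundaryRate
  split_ifs <;> simp [ha, hb]

/-- The nonzero points of the rectangle `[0, m] × [0, n]`. -/
def grid (m n : ℕ) : Finset (ℕ × ℕ) :=
  (Finset.range (m + 1) ×ˢ Finset.range (n + 1)).erase (0, 0)

theorem mem_grid {m n : ℕ} {x : ℕ × ℕ} : x ∈ grid m n ↔ x ≠ (0, 0) ∧ x.1 ≤ m ∧ x.2 ≤ n := by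
  simp [grid]

theorem prod_grid_vertical {M : Type*} [CommMonoid M] (m n : ℕ) (A : ℕ × ℕ → M) :
    ∏ x ∈ grid m n, (if x.1 = 0 then A x else 1) = ∏ j ∈ Finset.Icc 1 n, A (0, j) := by
  rw [← Finset.prod_filter]
  refine Finset.prod_nbij' (fun x => x.2) (fun j => (0, j)) ?_ ?_ ?_ ?_ ?_
  all_goals
    simp only [Finset.mem_filter, mem_grid, Finset.mem_Icc, Prod.forall, Prod.mk.injEq, ne_eq]
    grind

theorem prod_grid_horizontal {M : Type*} [CommMonoid M] (m n : ℕ) (A : ℕ × ℕ → M) :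
    ∏ x ∈ grid m n, (if x.2 = 0 then A x else 1) = ∏ i ∈ Finset.Icc 1 m, A (i, 0) := by
  rw [← Finset.prod_filter]
  refine Finset.prod_nbij' (fun x => x.1) (fun i => (i, 0)) ?_ ?_ ?_ ?_ ?_
  all_goals
    simp only [Finset.mem_filter, mem_grid, Finset.mem_Icc, Prod.forall, Prod.mk.injEq, ne_eq]
    grind

/-- `D` describes the weights after the corner flips of `j` full rows and of `i` cells of the next
row: it preserves the law of the weights, and the axis slots hold the increments of the last-passage
value along a down-right path. -/
structure IsFlipState (a b : ℝ) (m n i j : ℕ) (D : (ℕ × ℕ → ℝ) → (ℕ × ℕ → ℝ)) : Prop where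
  measurable : Measurable D
  lmarginal_comp : ∀ f : (ℕ × ℕ → ℝ) → ENNReal, Measurable f →
    lmarginal (fun x => expMeasure (boundaryRate a b x)) (grid m n) (fun X => f (D X)) =
      lmarginal (fun x => expMeasure (boundaryRate a b x)) (grid m n) f
  processed : ∀ X p, p < i → D X (p + 1, 0) = lpp X (p + 1) (j + 1) - lpp X p (j + 1)
  unprocessed : ∀ X p, i ≤ p → p < m → D X (p + 1, 0) = lpp X (p + 1) j - lpp X p j
  west : ∀ X, D X (0, j + 1) = lpp X i (j + 1) - lpp X i j
  untouched : ∀ X p q, j + 1 < q ∨ q = j + 1 ∧ i < p → D X (p, q) = X (p, q)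

theorem isFlipState_id (a b : ℝ) (m n : ℕ) : IsFlipState a b m n 0 0 id where
  measurable := measurable_id
  lmarginal_comp _ _ := rfl
  processed := by simp
  unprocessed X p _ _ := by
    rw [lpp_zero_right, lpp_zero_right, Finset.sum_Icc_succ_top (by omega)]
    simp
  west X := by simp [lpp_zero_left]
  untouched := by simp

/-- Before the flip, the slots `(i + 1, 0)` and `(0, j + 1)` hold the increments on the south and
west sides of the cell. By the recursion for `lpp` the flip replaces them by those on its north and
east sides. The condition `a + b = 1` is the Burke rate condition, the bulk rate being `1`. -/
theorem IsFlipState.flip {a b : ℝ} (ha : 0 < a) (hb : 0 < b) (hab : a + b = 1) {m n i j : ℕ}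
    {D : (ℕ × ℕ → ℝ) → (ℕ × ℕ → ℝ)} (hD : IsFlipState a b m n i j D) (hi : i < m) (hj : j < n) :
    IsFlipState a b m n (i + 1) j
      (fun X => cornerFlip (i + 1, 0) (0, j + 1) (i + 1, j + 1) (D X)) := by
  have hx : ∀ X, D X (i + 1, 0) = lpp X (i + 1) j - lpp X i j :=
    fun X => hD.unprocessed X i le_rfl hi
  have hs : ∀ X, D X (i + 1, j + 1) = X (i + 1, j + 1) :=
    fun X => hD.untouched X _ _ (Or.inr ⟨rfl, by omega⟩)
  refine ⟨(measurable_cornerFlip _ _ _).comp hD.measurable, fun f hf => ?_, ?_, ?_, ?_, ?_⟩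
  · refine (hD.lmarginal_comp _ (hf.comp (measurable_cornerFlip _ _ _))).trans ?_
    refine lmarginal_cornerFlip _ (boundaryRate_pos ha hb) ?_ ?_ ?_ ?_ ?_ ?_ ?_ hf
    · simp [mem_grid]; omega
    · simp [mem_grid]; omega
    · simp [mem_grid]; omega
    · simp
    · simp
    · simp
    · simp [boundaryRate, hab]
  · intro X p hp
    rcases Nat.lt_succ_iff_lt_or_eq.1 hp with hp | rfl
    · rw [← hD.processed X p hp]
      simp [cornerFlip, hp.ne]
    · simp only [cornerFlip, Prod.mk.injEq, Nat.add_eq_zero_iff, one_ne_zero, and_false,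
        Function.update_apply, if_false, if_true, hx, hD.west, hs,
        lpp_succ_succ X p j, eq_comm (a := (0 : ℕ))]
      grind
  · intro X p hp hpm
    rw [← hD.unprocessed X p (by omega) hpm]
    have : p ≠ i := by omega
    simp [cornerFlip, this]
  · intro X
    simp only [cornerFlip, Prod.mk.injEq, Nat.add_eq_zero_iff, one_ne_zero, and_false,
      Function.update_apply, and_true, if_false, if_true, hx, hD.west, hs,
      lpp_succ_succ X i j, eq_comm (a := (0 : ℕ))]
    grind
  · intro X p q h
    rw [← hD.untouched X p q (by omega)]
    have h1 : (p, q) ≠ (i + 1, 0) := by simp; omega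
    have h2 : (p, q) ≠ (0, j + 1) := by simp; omega
    have h3 : (p, q) ≠ (i + 1, j + 1) := by simp; omega
    simp [cornerFlip, Function.update_of_ne, h1, h2, h3]

/-- At the end of a row all north increments serve as south increments of the next row, and the next
west slot still holds its original axis weight. -/
theorem IsFlipState.next_row {a b : ℝ} {m n j : ℕ} {D : (ℕ × ℕ → ℝ) → (ℕ × ℕ → ℝ)}
    (hD : IsFlipState a b m n m j D) : IsFlipState a b m n 0 (j + 1) D where
  measurable := hD.measurable
  lmarginal_comp := hD.lmarginal_comp
  processed := by simp
  unprocessed X p _ hp := hD.processed X p hp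
  west X := by
    rw [hD.untouched X _ _ (Or.inl (by omega)), lpp_zero_left, lpp_zero_left,
      Finset.sum_Icc_succ_top (by omega)]
    simp
  untouched X p q h := hD.untouched X p q (by omega)

theorem exists_isFlipState {a b : ℝ} (ha : 0 < a) (hb : 0 < b) (hab : a + b = 1) (m n : ℕ) :
    ∀ j ≤ n, ∃ D, IsFlipState a b m n 0 j D := by
  intro j
  induction j with
  | zero => exact fun _ => ⟨id, isFlipState_id a b m n⟩
  | succ j ih =>
    intro hj
    have hrow : ∀ i ≤ m, ∃ D, IsFlipState a b m n i j D := by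
      intro i
      induction i with
      | zero => exact fun _ => ih (by omega)
      | succ i ihi =>
        intro hi
        obtain ⟨D, hD⟩ := ihi (by omega)
        exact ⟨_, hD.flip ha hb hab (by omega) (by omega)⟩
    obtain ⟨D, hD⟩ := hrow m le_rfl
    exact ⟨D, hD.next_row⟩

/-- The increments of the last-passage value along the top row have the law of the weights on the
`e₁`-axis. -/
theorem exists_topRow_increments {a b : ℝ} (ha : 0 < a) (hb : 0 < b) (hab : a + b = 1)
    (m n : ℕ) : ∃ D : (ℕ × ℕ → ℝ) → (ℕ × ℕ → ℝ), Measurable D ∧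
      (∀ f : (ℕ × ℕ → ℝ) → ENNReal, Measurable f →
        lmarginal (fun x => expMeasure (boundaryRate a b x)) (grid m n) (fun X => f (D X)) =
          lmarginal (fun x => expMeasure (boundaryRate a b x)) (grid m n) f) ∧
      ∀ X, lpp X m n = (∑ j ∈ Finset.Icc 1 n, X (0, j)) + ∑ i ∈ Finset.Icc 1 m, D X (i, 0) := by
  obtain ⟨D, hD⟩ := exists_isFlipState ha hb hab m n n le_rfl
  refine ⟨D, hD.measurable, hD.lmarginal_comp, fun X => ?_⟩
  have h : ∀ k ≤ m, ∑ i ∈ Finset.Icc 1 k, D X (i, 0) = lpp X k n - lpp X 0 n := by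
    intro k
    induction k with
    | zero => simp
    | succ k ih =>
      intro hk
      rw [Finset.sum_Icc_succ_top (by omega), ih (by omega),
        hD.unprocessed X k (Nat.zero_le _) (by omega)]
      ring
  rw [h m le_rfl, lpp_zero_left]
  ring

/-! ### The exact moment generating function. -/

theorem ofReal_exp_mul_sum {ι : Type*} (s : Finset ι) (t : ℝ) (f : ι → ℝ) :
    ENNReal.ofReal (Real.exp (t * ∑ i ∈ s, f i)) =
      ∏ i ∈ s, ENNReal.ofReal (Real.exp (t * f i)) := by
  rw [Finset.mul_sum, Real.exp_sum, ENNReal.ofReal_prod_of_nonneg fun _ _ => (Real.exp_pos _).le]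

/-- Write the value as the sum of the `e₂`-axis weights and the top-row increments. The exponential
of the first sum tilts the `e₂`-rate from `w` to `z` and contributes `(w / z) ^ n`. Under the
resulting stationary law the increments are independent `Exp(1 - z)`, and their moment generating
function contributes the other factor. -/
theorem lmarginal_exp_lpp {z w : ℝ} (hz0 : 0 < z) (hz1 : z < 1) (hw0 : 0 < w) (hw1 : w < 1)
    (m n : ℕ) (X₀ : ℕ × ℕ → ℝ) :
    lmarginal (fun x => expMeasure (boundaryRate (1 - z) w x)) (grid m n)
      (fun X => ENNReal.ofReal (Real.exp ((w - z) * lpp X m n))) X₀ =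
      ENNReal.ofReal ((w / z) ^ n * ((1 - z) / (1 - w)) ^ m) := by
  have hz1' : 0 < 1 - z := by linarith
  have hw1' : 0 < 1 - w := by linarith
  have p1 : ∀ x, IsProbabilityMeasure (expMeasure (boundaryRate (1 - z) w x)) := fun x =>
    isProbabilityMeasure_expMeasure (boundaryRate_pos hz1' hw0 x)
  have p2 : ∀ x, IsProbabilityMeasure (expMeasure (boundaryRate (1 - z) z x)) := fun x =>
    isProbabilityMeasure_expMeasure (boundaryRate_pos hz1' hz0 x)
  have p3 : ∀ x, IsProbabilityMeasure (expMeasure (boundaryRate (1 - w) z x)) := fun x =>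
    isProbabilityMeasure_expMeasure (boundaryRate_pos hw1' hz0 x)
  -- The flips are used at the stationary rates `1 - z` and `z` reached after the first tilt; the
  -- formula for the value in terms of `D` is deterministic and holds under any law.
  obtain ⟨D, hD, hinv, hsum⟩ := exists_topRow_increments hz1' hz0 (by ring) m n
  have hE : Measurable fun x : ℝ => ENNReal.ofReal (Real.exp ((w - z) * x)) := by fun_prop
  have hsplit : (fun X : ℕ × ℕ → ℝ => ENNReal.ofReal (Real.exp ((w - z) * lpp X m n))) =
      fun X => (∏ x ∈ grid m n,
        if x.1 = 0 then ENNReal.ofReal (Real.exp ((w - z) * X x)) else 1) *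
        ENNReal.ofReal (Real.exp ((w - z) * ∑ i ∈ Finset.Icc 1 m, D X (i, 0))) := by
    funext X
    rw [prod_grid_vertical m n (fun x => ENNReal.ofReal (Real.exp ((w - z) * X x))),
      ← ofReal_exp_mul_sum, ← ENNReal.ofReal_mul (Real.exp_pos _).le, ← Real.exp_add, ← mul_add,
      ← hsum]
  have hF : Measurable fun X : ℕ × ℕ → ℝ =>
      ENNReal.ofReal (Real.exp ((w - z) * ∑ i ∈ Finset.Icc 1 m, X (i, 0))) := by fun_prop
  have h1 := lmarginal_prod_mul (fun x => expMeasure (boundaryRate (1 - z) w x))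
    (fun x => expMeasure (boundaryRate (1 - z) z x))
    -- `boundaryRate` takes its `e₁`-axis value at the origin, so the origin must be excluded from
    -- the tilt of the `e₂`-axis for the one-coordinate identity to hold at every index.
    (f := fun x t => if x.1 = 0 ∧ x.2 ≠ 0 then ENNReal.ofReal (Real.exp ((w - z) * t)) else 1)
    (fun x => by split_ifs <;> fun_prop)
    (fun x => if x.1 = 0 ∧ x.2 ≠ 0 then ENNReal.ofReal (w / z) else 1)
    (fun x g hg => by
      by_cases hx : x.1 = 0 ∧ x.2 ≠ 0
      · simp only [hx, boundaryRate, if_false, if_true, ne_eq, not_false_iff, and_true]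
        have := lintegral_exp_mul_expMeasure (t := w - z) hw0 (by linarith) hg
        simpa using this
      · simp only [hx, if_false, one_mul]
        have : boundaryRate (1 - z) w x = boundaryRate (1 - z) z x := by
          unfold boundaryRate; grind
        rw [this]) (grid m n) (hF.comp hD)
  have h2 := lmarginal_prod_mul (fun x => expMeasure (boundaryRate (1 - z) z x))
    (fun x => expMeasure (boundaryRate (1 - w) z x))
    (f := fun x t => if x.2 = 0 then ENNReal.ofReal (Real.exp ((w - z) * t)) else 1)
    (fun x => by split_ifs <;> fun_prop)
    (fun x => if x.2 = 0 then ENNReal.ofReal ((1 - z) / (1 - w)) else 1)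
    (fun x g hg => by
      by_cases hx : x.2 = 0
      · simp only [hx, boundaryRate]
        have := lintegral_exp_mul_expMeasure (t := w - z) hz1' (by linarith) hg
        simpa using this
      · simp only [hx, if_false, one_mul, boundaryRate]) (grid m n)
    (measurable_const (a := (1 : ENNReal)))
  have hgrid : ∀ (A : ℕ × ℕ → ENNReal), ∏ x ∈ grid m n, (if x.1 = 0 then A x else 1) =
      ∏ x ∈ grid m n, (if x.1 = 0 ∧ x.2 ≠ 0 then A x else 1) := by
    intro A
    refine Finset.prod_congr rfl fun x hx => ?_
    have := (mem_grid.1 hx).1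
    grind
  rw [hsplit]
  simp only [hgrid]
  simp only [Function.comp_def] at h1
  rw [h1, hinv _ hF]
  have hF2 : (fun X : ℕ × ℕ → ℝ =>
      ENNReal.ofReal (Real.exp ((w - z) * ∑ i ∈ Finset.Icc 1 m, X (i, 0)))) =
      fun X => (∏ x ∈ grid m n,
        if x.2 = 0 then ENNReal.ofReal (Real.exp ((w - z) * X x)) else 1) * 1 := by
    funext X
    rw [prod_grid_horizontal m n (fun x => ENNReal.ofReal (Real.exp ((w - z) * X x))),
      ← ofReal_exp_mul_sum, mul_one]
  rw [hF2, h2, ← hgrid, prod_grid_vertical m n (fun _ => ENNReal.ofReal (w / z)),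
    prod_grid_horizontal m n (fun _ => ENNReal.ofReal ((1 - z) / (1 - w)))]
  simp only [lmarginal, lintegral_const, measure_univ, mul_one, Finset.prod_const, Nat.card_Icc,
    Nat.add_sub_cancel]
  rw [← ENNReal.ofReal_pow (by positivity), ← ENNReal.ofReal_pow (by positivity),
    ← ENNReal.ofReal_mul (by positivity)]

/-! ### Transfer to random weights on a probability space. -/

/-- Independent exponential weights of rate `a` on the `e₁`-axis, `b` on the `e₂`-axis and `1` in
the bulk. -/
structure IsExpWeights {Ω : Type*} [MeasurableSpace Ω] (a b : ℝ) (P : Measure Ω)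
    (X : ℕ × ℕ → Ω → ℝ) : Prop where
  hasLaw : ∀ x : ℕ × ℕ, x ≠ (0, 0) → HasLaw (X x) (expMeasure (boundaryRate a b x)) P
  indep : iIndepFun (fun x : {x : ℕ × ℕ // x ≠ (0, 0)} => X x.1) P

theorem IsStationaryWeights.isExpWeights {Ω : Type*} [MeasurableSpace Ω] {ρ : ℝ} {P : Measure Ω}
    {X : ℕ × ℕ → Ω → ℝ} (h : IsStationaryWeights ρ P X) : IsExpWeights (1 - ρ) ρ P X :=
  ⟨h.hasLaw, h.indep⟩

theorem lpp_updateFinset {Ω : Type*} (X : ℕ × ℕ → Ω → ℝ) (m n : ℕ) (ω : Ω) :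
    lpp (Function.updateFinset (0 : ℕ × ℕ → ℝ) (grid m n) (fun x => X x ω)) m n =
      lpp (fun x => X x ω) m n := by
  refine lpp_congr m n fun x h0 h1 h2 => ?_
  simp [Function.updateFinset, mem_grid.2 ⟨h0, h1, h2⟩]

namespace IsExpWeights

variable {Ω : Type*} [MeasurableSpace Ω] {a b : ℝ} {P : Measure Ω} {X : ℕ × ℕ → Ω → ℝ}

theorem scaleBoundary (h : IsExpWeights a b P X) (ha : 0 < a) (hb : 0 < b) {u v : ℝ}
    (hu : 0 < u) (hv : 0 < v) :
    IsExpWeights (a / u) (b / v) P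
      (fun x ω => CornerGrowth.scaleBoundary u v (fun y => X y ω) x) where
  hasLaw x hx := by
    have hc : 0 < (if x.2 = 0 then u else if x.1 = 0 then v else 1 : ℝ) := by
      split_ifs <;> simp [hu, hv]
    have h1 := map_mul_expMeasure (boundaryRate_pos ha hb x) hc
    have h2 : HasLaw (fun t : ℝ => (if x.2 = 0 then u else if x.1 = 0 then v else 1 : ℝ) * t)
        (expMeasure (boundaryRate (a / u) (b / v) x)) (expMeasure (boundaryRate a b x)) := by
      refine ⟨by fun_prop, ?_⟩
      rw [h1]
      congr 1
      unfold boundaryRate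
      split_ifs <;> simp
    exact h2.fun_comp (h.hasLaw x hx)
  indep := h.indep.comp (fun x t => (if x.1.2 = 0 then u else if x.1.1 = 0 then v else 1) * t)
    (fun x => by fun_prop)

theorem ae_nonneg (h : IsExpWeights a b P X) :
    ∀ᵐ ω ∂P, ∀ x : ℕ × ℕ, x ≠ (0, 0) → 0 ≤ X x ω := by
  rw [ae_all_iff]
  intro x
  by_cases hx : x = (0, 0)
  · simp [hx]
  · have := ((h.hasLaw x hx).ae_iff (p := fun t => 0 ≤ t)
      (measurableSet_setOfPred.1 measurableSet_Ici)).2 (ae_nonneg_expMeasure _)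
    filter_upwards [this] with ω hω _ using hω

/-- Setting the weights outside the rectangle to zero does not change the last-passage value and
turns expectations into finite product integrals, where the flips and tilts are available. -/
theorem lintegral_updateFinset [IsProbabilityMeasure P] (h : IsExpWeights a b P X) (m n : ℕ)
    {f : (ℕ × ℕ → ℝ) → ENNReal} (hf : Measurable f) :
    ∫⁻ ω, f (Function.updateFinset 0 (grid m n) (fun x => X x ω)) ∂P =
      lmarginal (fun x => expMeasure (boundaryRate a b x)) (grid m n) f 0 := by
  have hne : ∀ x : grid m n, x.1 ≠ (0, 0) := fun x => (mem_grid.1 x.2).1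
  have hind : iIndepFun (fun (x : grid m n) ω => X x ω) P :=
    h.indep.precomp (g := fun x : grid m n => ⟨x.1, hne x⟩) fun _ _ hxy =>
      Subtype.ext (congrArg (fun y : {x : ℕ × ℕ // x ≠ (0, 0)} => y.1) hxy)
  have hmeas : ∀ x : grid m n, AEMeasurable (X x) P := fun x => (h.hasLaw x (hne x)).aemeasurable
  have hmap := hind.map_fun_eq_pi_map hmeas
  have hmap' : P.map (fun ω (x : grid m n) => X x ω) =
      Measure.pi fun x : grid m n => expMeasure (boundaryRate a b x) := by
    rw [hmap]
    congr 1
    funext x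
    exact (h.hasLaw x (hne x)).map_eq
  rw [lmarginal, ← hmap']
  exact (lintegral_map' (hf.comp measurable_updateFinset).aemeasurable
    (aemeasurable_pi_iff.2 hmeas)).symm

theorem aemeasurable_updateFinset (h : IsExpWeights a b P X) (m n : ℕ) :
    AEMeasurable (fun ω => Function.updateFinset (0 : ℕ × ℕ → ℝ) (grid m n) (fun x => X x ω)) P :=
  measurable_updateFinset.comp_aemeasurable
    (aemeasurable_pi_iff.2 fun x => (h.hasLaw x (mem_grid.1 x.2).1).aemeasurable)

theorem aemeasurable_lpp (h : IsExpWeights a b P X) (m n : ℕ) :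
    AEMeasurable (fun ω => lpp (fun x => X x ω) m n) P := by
  simp only [← lpp_updateFinset X m n]
  exact (measurable_lpp m n).comp_aemeasurable (h.aemeasurable_updateFinset m n)

theorem lintegral_exp_lpp [IsProbabilityMeasure P] {z w : ℝ} (h : IsExpWeights (1 - z) w P X)
    (hz0 : 0 < z) (hz1 : z < 1) (hw0 : 0 < w) (hw1 : w < 1) (m n : ℕ) :
    ∫⁻ ω, ENNReal.ofReal (Real.exp ((w - z) * lpp (fun x => X x ω) m n)) ∂P =
      ENNReal.ofReal ((w / z) ^ n * ((1 - z) / (1 - w)) ^ m) := by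
  rw [← lmarginal_exp_lpp hz0 hz1 hw0 hw1 m n 0, ← h.lintegral_updateFinset m n (by fun_prop)]
  simp only [lpp_updateFinset]

theorem integrable_exp_lpp [IsProbabilityMeasure P] {z w : ℝ} (h : IsExpWeights (1 - z) w P X)
    (hz0 : 0 < z) (hz1 : z < 1) (hw0 : 0 < w) (hw1 : w < 1) (m n : ℕ) :
    Integrable (fun ω => Real.exp ((w - z) * lpp (fun x => X x ω) m n)) P := by
  refine ⟨(Real.measurable_exp.comp_aemeasurable
    ((h.aemeasurable_lpp m n).const_mul _)).aestronglyMeasurable, ?_⟩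
  rw [hasFiniteIntegral_iff_ofReal (Filter.Eventually.of_forall fun _ => (Real.exp_pos _).le),
    h.lintegral_exp_lpp hz0 hz1 hw0 hw1]
  exact ENNReal.ofReal_lt_top

theorem integral_exp_lpp [IsProbabilityMeasure P] {z w : ℝ} (h : IsExpWeights (1 - z) w P X)
    (hz0 : 0 < z) (hz1 : z < 1) (hw0 : 0 < w) (hw1 : w < 1) (m n : ℕ) :
    ∫ ω, Real.exp ((w - z) * lpp (fun x => X x ω) m n) ∂P =
      (w / z) ^ n * ((1 - z) / (1 - w)) ^ m := by
  have : 0 < 1 - z := by linarith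
  have : 0 < 1 - w := by linarith
  rw [integral_eq_lintegral_of_nonneg_ae
    (Filter.Eventually.of_forall fun _ => (Real.exp_pos _).le)
    (h.integrable_exp_lpp hz0 hz1 hw0 hw1 m n).aestronglyMeasurable,
    h.lintegral_exp_lpp hz0 hz1 hw0 hw1, ENNReal.toReal_ofReal (by positivity)]

theorem integrable_weight (h : IsExpWeights a b P X) (ha : 0 < a) (hb : 0 < b) {x : ℕ × ℕ}
    (hx : x ≠ (0, 0)) : Integrable (X x) P :=
  (IdentDistrib.mk (h.hasLaw x hx).aemeasurable aemeasurable_id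
    (by rw [(h.hasLaw x hx).map_eq, Measure.map_id])).integrable_iff.2
    (integrable_id_expMeasure (boundaryRate_pos ha hb x))

theorem integral_weight (h : IsExpWeights a b P X) (ha : 0 < a) (hb : 0 < b) {x : ℕ × ℕ}
    (hx : x ≠ (0, 0)) : ∫ ω, X x ω ∂P = 1 / boundaryRate a b x := by
  rw [(h.hasLaw x hx).integral_eq, integral_id_expMeasure (boundaryRate_pos ha hb x)]

/-- The value is a sum of `n` weights on the `e₂`-axis and `m` top-row increments, and the latter
have the law of the `e₁`-axis weights. Linearity of expectation needs no independence between the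
two groups. -/
theorem integral_lpp [IsProbabilityMeasure P] (h : IsExpWeights a b P X) (ha : 0 < a)
    (hb : 0 < b) (hab : a + b = 1) (m n : ℕ) :
    ∫ ω, lpp (fun x => X x ω) m n ∂P = m / a + n / b := by
  obtain ⟨D, hD, hinv, hsum⟩ := exists_topRow_increments ha hb hab m n
  set Y : Ω → ℕ × ℕ → ℝ := fun ω =>
    Function.updateFinset (0 : ℕ × ℕ → ℝ) (grid m n) (fun x => X x ω) with hY
  have hYm : AEMeasurable Y P := h.aemeasurable_updateFinset m n
  have hid : IdentDistrib (fun ω => D (Y ω)) Y P P := by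
    refine ⟨hD.comp_aemeasurable hYm, hYm, ?_⟩
    refine Measure.ext_of_lintegral _ fun f hf => ?_
    refine (lintegral_map' hf.aemeasurable (hD.comp_aemeasurable hYm)).trans
      (Eq.trans ?_ (lintegral_map' hf.aemeasurable hYm).symm)
    exact (h.lintegral_updateFinset m n (hf.comp hD)).trans
      ((hinv f hf).symm ▸ (h.lintegral_updateFinset m n hf).symm)
  have hYx : ∀ x ∈ grid m n, ∀ ω, Y ω x = X x ω := fun x hx ω => by
    simp [hY, Function.updateFinset, hx]
  have hI : ∀ i ∈ Finset.Icc 1 m, (i, 0) ∈ grid m n := fun i hi => by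
    rw [Finset.mem_Icc] at hi
    simp [mem_grid]; omega
  have hJ : ∀ j ∈ Finset.Icc 1 n, (0, j) ∈ grid m n := fun j hj => by
    rw [Finset.mem_Icc] at hj
    simp [mem_grid]; omega
  have hYint : ∀ x ∈ grid m n, Integrable (fun ω => Y ω x) P := fun x hx => by
    simp only [hYx x hx]
    exact h.integrable_weight ha hb (mem_grid.1 hx).1
  have hYval : ∀ x ∈ grid m n, ∫ ω, Y ω x ∂P = 1 / boundaryRate a b x := fun x hx => by
    simp only [hYx x hx]
    exact h.integral_weight ha hb (mem_grid.1 hx).1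
  have hDid : ∀ x, IdentDistrib (fun ω => D (Y ω) x) (fun ω => Y ω x) P P := fun x =>
    hid.comp (measurable_pi_apply x)
  have e : (fun ω => lpp (fun x => X x ω) m n) = fun ω =>
      (∑ j ∈ Finset.Icc 1 n, Y ω (0, j)) + ∑ i ∈ Finset.Icc 1 m, D (Y ω) (i, 0) := by
    funext ω
    rw [← lpp_updateFinset X m n, hsum]
  rw [e, integral_add, integral_finsetSum, integral_finsetSum,
    Finset.sum_congr rfl (fun j hj => hYval _ (hJ j hj)),
    Finset.sum_congr rfl (fun i hi => ((hDid (i, 0)).integral_eq.trans (hYval _ (hI i hi))))]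
  · have h1 : ∑ j ∈ Finset.Icc 1 n, 1 / boundaryRate a b (0, j) = n / b := by
      rw [Finset.sum_congr rfl (g := fun _ => 1 / b) fun j hj => by
        rw [Finset.mem_Icc] at hj
        simp [boundaryRate, show j ≠ 0 by omega]]
      simp [div_eq_mul_inv]
    have h2 : ∑ i ∈ Finset.Icc 1 m, 1 / boundaryRate a b (i, 0) = m / a := by
      simp [boundaryRate, div_eq_mul_inv]
    rw [h1, h2, add_comm]
  · exact fun i hi => (hDid _).integrable_iff.2 (hYint _ (hI i hi))
  · exact fun j hj => hYint _ (hJ j hj)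
  · exact integrable_finsetSum _ fun j hj => hYint _ (hJ j hj)
  · exact integrable_finsetSum _ fun i hi => (hDid _).integrable_iff.2 (hYint _ (hI i hi))

end IsExpWeights

/-! ### Expansion of the logarithmic moment generating function at `ρ`. -/

/-- The function whose increment `logGrowth m n w - logGrowth m n z` is the logarithm of the moment
generating function of the last-passage value. -/
noncomputable def logGrowth (m n : ℕ) (x : ℝ) : ℝ := n * Real.log x - m * Real.log (1 - x)

/-- The mean `m / (1 - x) + n / x` of the stationary last-passage value of parameter `x`. -/
noncomputable def meanGrowth (m n : ℕ) (x : ℝ) : ℝ := m / (1 - x) + n / x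

/-- The deviation of the direction `(m, n)` from the characteristic direction of parameter `x`. -/
noncomputable def skew (m n : ℕ) (x : ℝ) : ℝ := m / (1 - x) ^ 2 - n / x ^ 2

theorem exp_logGrowth_sub {z w : ℝ} (hz0 : 0 < z) (hz1 : z < 1) (hw0 : 0 < w) (hw1 : w < 1)
    (m n : ℕ) : (w / z) ^ n * ((1 - z) / (1 - w)) ^ m =
      Real.exp (logGrowth m n w - logGrowth m n z) := by
  have hz1' : 0 < 1 - z := by linarith
  have hw1' : 0 < 1 - w := by linarith
  rw [← Real.exp_log (by positivity : 0 < (w / z) ^ n * ((1 - z) / (1 - w)) ^ m),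
    Real.log_mul (by positivity) (by positivity), Real.log_pow, Real.log_pow,
    Real.log_div hw0.ne' hz0.ne', Real.log_div hz1'.ne' hw1'.ne']
  congr 1
  unfold logGrowth
  ring

theorem hasDerivAt_logGrowth (m n : ℕ) {x : ℝ} (hx0 : 0 < x) (hx1 : x < 1) :
    HasDerivAt (logGrowth m n) (meanGrowth m n x) x := by
  have h1 : HasDerivAt (fun y : ℝ => 1 - y) (-1) x := by
    simpa using (hasDerivAt_id x).const_sub 1
  have h := ((Real.hasDerivAt_log hx0.ne').const_mul (n : ℝ)).sub
    ((h1.log (by linarith)).const_mul (m : ℝ))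
  convert! h using 1
  unfold meanGrowth
  have : 1 - x ≠ 0 := by linarith
  field_simp
  ring

/-- An exact second-order expansion whose remainder coefficient is nonnegative, comparable to `m +
n` away from the endpoints, and at least `m + n` throughout. It serves both the upper and the lower
estimate. -/
theorem meanGrowth_sub (m n : ℕ) {ρ x : ℝ} (hρ0 : 0 < ρ) (hρ1 : ρ < 1) (hx0 : 0 < x)
    (hx1 : x < 1) : meanGrowth m n x - meanGrowth m n ρ = (x - ρ) * skew m n ρ +
      (x - ρ) ^ 2 * (m / ((1 - ρ) ^ 2 * (1 - x)) + n / (ρ ^ 2 * x)) := by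
  have : 1 - x ≠ 0 := by linarith
  have : 1 - ρ ≠ 0 := by linarith
  unfold meanGrowth skew
  field_simp
  ring

/-- The mean value inequality for `logGrowth` minus its linear part, on the window of radius `h`
about `ρ`. There the condition `h ≤ r / 2` keeps `x` and `1 - x` at least `r / 2`. -/
theorem abs_logGrowth_sub_le (m n : ℕ) {ρ r h z w : ℝ} (hr : 0 < r) (hr0 : r ≤ ρ)
    (hr1 : r ≤ 1 - ρ) (hh : h ≤ r / 2) (hz : |z - ρ| ≤ h) (hw : |w - ρ| ≤ h) :
    |logGrowth m n w - logGrowth m n z - (w - z) * meanGrowth m n ρ| ≤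
      (h * |skew m n ρ| + 2 / r ^ 3 * h ^ 2 * (m + n)) * |w - z| := by
  have hmem : ∀ x ∈ Set.Icc (ρ - h) (ρ + h), r / 2 ≤ x ∧ r / 2 ≤ 1 - x := fun x hx =>
    ⟨by linarith [hx.1], by linarith [hx.2]⟩
  have hder : ∀ x ∈ Set.Icc (ρ - h) (ρ + h), HasDerivWithinAt
      (fun y => logGrowth m n y - y * meanGrowth m n ρ) (meanGrowth m n x - meanGrowth m n ρ)
      (Set.Icc (ρ - h) (ρ + h)) x := by
    intro x hx
    have := hmem x hx
    refine (((hasDerivAt_logGrowth m n (by linarith) (by linarith)).sub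
      ((hasDerivAt_id x).mul_const _)).congr_deriv ?_).hasDerivWithinAt
    simp
  have hbd : ∀ x ∈ Set.Icc (ρ - h) (ρ + h), ‖meanGrowth m n x - meanGrowth m n ρ‖ ≤
      h * |skew m n ρ| + 2 / r ^ 3 * h ^ 2 * (m + n) := by
    intro x hx
    obtain ⟨h1, h2⟩ := hmem x hx
    have hxρ : |x - ρ| ≤ h := abs_le.2 ⟨by linarith [hx.1], by linarith [hx.2]⟩
    rw [meanGrowth_sub m n (by linarith) (by linarith) (by linarith) (by linarith),
      Real.norm_eq_abs]
    have e1 : (m : ℝ) / ((1 - ρ) ^ 2 * (1 - x)) ≤ 2 / r ^ 3 * m := by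
      calc (m : ℝ) / ((1 - ρ) ^ 2 * (1 - x)) ≤ m / (r ^ 2 * (r / 2)) := by gcongr
        _ = 2 / r ^ 3 * m := by field_simp
    have e2 : (n : ℝ) / (ρ ^ 2 * x) ≤ 2 / r ^ 3 * n := by
      calc (n : ℝ) / (ρ ^ 2 * x) ≤ n / (r ^ 2 * (r / 2)) := by gcongr
        _ = 2 / r ^ 3 * n := by field_simp
    have p1 : 0 ≤ (m : ℝ) / ((1 - ρ) ^ 2 * (1 - x)) := by
      have : 0 < 1 - x := by linarith
      positivity
    have p2 : 0 ≤ (n : ℝ) / (ρ ^ 2 * x) := by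
      have : 0 < x := by linarith
      positivity
    calc |(x - ρ) * skew m n ρ +
          (x - ρ) ^ 2 * (m / ((1 - ρ) ^ 2 * (1 - x)) + n / (ρ ^ 2 * x))|
        ≤ |(x - ρ) * skew m n ρ| +
          |(x - ρ) ^ 2 * (m / ((1 - ρ) ^ 2 * (1 - x)) + n / (ρ ^ 2 * x))| := abs_add_le _ _
      _ = |x - ρ| * |skew m n ρ| +
          |x - ρ| ^ 2 * (m / ((1 - ρ) ^ 2 * (1 - x)) + n / (ρ ^ 2 * x)) := by
          rw [abs_mul, abs_mul, abs_of_nonneg (add_nonneg p1 p2), abs_pow]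
      _ ≤ h * |skew m n ρ| + h ^ 2 * (2 / r ^ 3 * m + 2 / r ^ 3 * n) := by gcongr
      _ = _ := by ring
  have := (convex_Icc (ρ - h) (ρ + h)).norm_image_sub_le_of_norm_hasDerivWithin_le hder hbd
    (x := z) (y := w) ⟨by linarith [(abs_le.1 hz).1], by linarith [(abs_le.1 hz).2]⟩
    ⟨by linarith [(abs_le.1 hw).1], by linarith [(abs_le.1 hw).2]⟩
  rw [Real.norm_eq_abs, Real.norm_eq_abs] at this
  convert this using 2
  ring

/-- The remainder coefficient in `meanGrowth_sub` is at least `m + n`, because its denominators are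
at most `1`. Hence `logGrowth` minus the stated cubic polynomial is monotone. -/
theorem logGrowth_sub_ge (m n : ℕ) {ρ z w : ℝ} (hρ0 : 0 < ρ) (hρ1 : ρ < 1) (hz : 0 < z)
    (hzw : z ≤ w) (hw : w < 1) :
    (w - z) * meanGrowth m n ρ + ((w - ρ) ^ 2 - (z - ρ) ^ 2) * (skew m n ρ / 2) +
      ((w - ρ) ^ 3 - (z - ρ) ^ 3) * ((m + n) / 3) ≤ logGrowth m n w - logGrowth m n z := by
  have hder : ∀ x ∈ Set.Ioo (0 : ℝ) 1, HasDerivAt (fun y => logGrowth m n y - y * meanGrowth m n ρ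
      - (y - ρ) ^ 2 * (skew m n ρ / 2) - (y - ρ) ^ 3 * ((m + n) / 3))
      ((x - ρ) ^ 2 * (m / ((1 - ρ) ^ 2 * (1 - x)) + n / (ρ ^ 2 * x) - (m + n))) x := by
    intro x hx
    have hid : HasDerivAt (fun y : ℝ => y - ρ) 1 x := (hasDerivAt_id x).sub_const ρ
    refine ((((hasDerivAt_logGrowth m n hx.1 hx.2).sub
      ((hasDerivAt_id x).mul_const _)).sub ((hid.pow 2).mul_const _)).sub
      ((hid.pow 3).mul_const _)).congr_deriv ?_
    have := meanGrowth_sub m n hρ0 hρ1 hx.1 hx.2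
    rw [sub_eq_iff_eq_add] at this
    rw [this]
    push_cast
    ring
  have hmono : MonotoneOn (fun y => logGrowth m n y - y * meanGrowth m n ρ
      - (y - ρ) ^ 2 * (skew m n ρ / 2) - (y - ρ) ^ 3 * ((m + n) / 3)) (Set.Ioo (0 : ℝ) 1) := by
    refine monotoneOn_of_hasDerivWithinAt_nonneg (convex_Ioo 0 1)
      (fun x hx => (hder x hx).continuousAt.continuousWithinAt)
      (fun x hx => (hder x (interior_subset hx)).hasDerivWithinAt) fun x hx => ?_
    have hx := interior_subset hx
    have hx0 : 0 < x := hx.1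
    have hx1 : 0 < 1 - x := by linarith [hx.2]
    have hρ1' : 0 < 1 - ρ := by linarith
    refine mul_nonneg (sq_nonneg _) ?_
    have e1 : (m : ℝ) ≤ m / ((1 - ρ) ^ 2 * (1 - x)) := by
      refine le_div_self (Nat.cast_nonneg m) (by positivity) ?_
      exact mul_le_one₀ (pow_le_one₀ hρ1'.le (by linarith)) hx1.le (by linarith)
    have e2 : (n : ℝ) ≤ n / (ρ ^ 2 * x) := by
      refine le_div_self (Nat.cast_nonneg n) (by positivity) ?_
      exact mul_le_one₀ (pow_le_one₀ hρ0.le hρ1.le) hx0.le hx.2.le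
    linarith
  have := hmono ⟨hz, by linarith⟩ ⟨by linarith, hw⟩ hzw
  simp only at this
  linarith

/-! ### Coupling across boundary rates, and pointwise inequalities. -/

theorem scaleBoundary_one (X : ℕ × ℕ → ℝ) : scaleBoundary 1 1 X = X := by
  funext x
  simp [scaleBoundary]

theorem lpp_scaleBoundary_le {X : ℕ × ℕ → ℝ} {u v : ℝ} (hu : u ≤ 1) (hv : v ≤ 1)
    (hX : ∀ x : ℕ × ℕ, x ≠ (0, 0) → 0 ≤ X x) (m n : ℕ) :
    lpp (scaleBoundary u v X) m n ≤ lpp X m n := by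
  refine lpp_mono m n fun x hx => ?_
  refine mul_le_of_le_one_left (hX x hx) ?_
  split_ifs <;> simp [hu, hv]

/-- The last-passage value with rate `1 - z` on the `e₁`-axis and `w` on the `e₂`-axis, coupled to
the weights `X` of rates `1 - ρ` and `ρ`. -/
noncomputable def coupledLpp {Ω : Type*} (ρ : ℝ) (X : ℕ × ℕ → Ω → ℝ) (m n : ℕ) (z w : ℝ) (ω : Ω) :
    ℝ :=
  lpp (scaleBoundary ((1 - ρ) / (1 - z)) (ρ / w) (fun x => X x ω)) m n

theorem coupledLpp_self {Ω : Type*} {ρ : ℝ} (hρ0 : 0 < ρ) (hρ1 : ρ < 1) (X : ℕ × ℕ → Ω → ℝ)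
    (m n : ℕ) (ω : Ω) : coupledLpp ρ X m n ρ ρ ω = lpp (fun x => X x ω) m n := by
  rw [coupledLpp, div_self (by linarith), div_self hρ0.ne', scaleBoundary_one]

/-- For any exponent `t ≥ 0`, one of the two parameters is moved so that their difference becomes
exactly `t`. Both terms on the right then have an exactly known expectation. -/
theorem exp_coupledLpp_le {Ω : Type*} (ρ : ℝ) (X : ℕ × ℕ → Ω → ℝ) (m n : ℕ) (z w c : ℝ) {t : ℝ}
    (ht : 0 ≤ t) (ω : Ω) :
    Real.exp (t * (coupledLpp ρ X m n z w ω - c)) ≤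
      Real.exp (t * (coupledLpp ρ X m n z (z + t) ω - c)) +
        Real.exp (t * (coupledLpp ρ X m n (w - t) w ω - c)) := by
  have h := lpp_scaleBoundary_le_max (fun x => X x ω) ((1 - ρ) / (1 - z)) (ρ / w)
    ((1 - ρ) / (1 - (w - t))) (ρ / (z + t)) m n
  rcases le_max_iff.1 h with h | h
  · refine le_add_of_le_of_nonneg ?_ (Real.exp_pos _).le
    exact Real.exp_le_exp.2 (mul_le_mul_of_nonneg_left (sub_le_sub_right h c) ht)
  · refine le_add_of_nonneg_of_le (Real.exp_pos _).le ?_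
    exact Real.exp_le_exp.2 (mul_le_mul_of_nonneg_left (sub_le_sub_right h c) ht)

/-- If `g₀ < c`, convexity bounds `c - g₀` by `2 (c - g₁)⁺ + (g₂ - c)⁺`. The constants come from `(2
A + B)² ≤ 8 A² + 2 B²` and `(x⁺)² ≤ 2 exp x`. -/
theorem sq_le_of_convex {s g₀ g₁ g₂ c : ℝ} (hs : 0 < s) (h : 2 * g₁ ≤ g₀ + g₂) :
    s ^ 2 * (g₀ - c) ^ 2 ≤ 2 * Real.exp (s * (g₀ - c)) + 16 * Real.exp (-s * (g₁ - c)) +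
      4 * Real.exp (s * (g₂ - c)) := by
  have hsq : ∀ x : ℝ, 0 ≤ x → x ^ 2 ≤ 2 * Real.exp x := fun x hx => by
    linarith [Real.quadratic_le_exp_of_nonneg hx]
  have hmax : ∀ x : ℝ, max x 0 ^ 2 ≤ 2 * Real.exp x := fun x => by
    rcases le_total 0 x with hx | hx
    · rw [max_eq_left hx]; exact hsq x hx
    · rw [max_eq_right hx]; simp [(Real.exp_pos x).le]
  rw [← mul_pow]
  rcases le_total 0 (s * (g₀ - c)) with h0 | h0
  · linarith [hsq _ h0, Real.exp_pos (-s * (g₁ - c)), Real.exp_pos (s * (g₂ - c))]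
  · have h1 := hmax (-s * (g₁ - c))
    have h2 := hmax (s * (g₂ - c))
    have h3 : -(s * (g₀ - c)) ≤ 2 * max (-s * (g₁ - c)) 0 + max (s * (g₂ - c)) 0 := by
      have := le_max_left (-s * (g₁ - c)) 0
      have := le_max_left (s * (g₂ - c)) 0
      nlinarith
    have h4 : (s * (g₀ - c)) ^ 2 ≤
        (2 * max (-s * (g₁ - c)) 0 + max (s * (g₂ - c)) 0) ^ 2 := by
      rw [← neg_sq]
      exact pow_le_pow_left₀ (by linarith) h3 2
    nlinarith [Real.exp_pos (s * (g₀ - c)),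
      sq_nonneg (2 * max (-s * (g₁ - c)) 0 - max (s * (g₂ - c)) 0)]

/-- The quadratic term suffices for `x ≤ M`; beyond `M`, `exp x ≤ exp (-M) exp (2 x)`. With `M`
free, the contribution of large values can be made as small as needed. -/
theorem exp_sub_one_sub_le {M : ℝ} (hM : 0 ≤ M) (x : ℝ) :
    Real.exp x - 1 - x ≤ Real.exp M * x ^ 2 + Real.exp (-M) * Real.exp (2 * x) := by
  have hM1 : 1 ≤ Real.exp M := Real.one_le_exp hM
  have hp : 0 < Real.exp (-M) * Real.exp (2 * x) := by positivity
  rcases le_total |x| 1 with h | h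
  · have := (le_abs_self _).trans (Real.abs_exp_sub_one_sub_id_le h)
    nlinarith [sq_nonneg x]
  · have hx2 : 1 ≤ x ^ 2 := by rw [← sq_abs]; nlinarith
    rcases le_total x 0 with hx | hx
    · have : Real.exp x ≤ 1 := Real.exp_le_one_iff.2 hx
      rw [abs_of_nonpos hx] at h
      nlinarith
    · rcases le_total x M with hxM | hxM
      · have := Real.exp_le_exp.2 hxM
        nlinarith
      · have : Real.exp x ≤ Real.exp (-M) * Real.exp (2 * x) := by
          rw [← Real.exp_add]
          exact Real.exp_le_exp.2 (by linarith)
        nlinarith [sq_nonneg x]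

theorem IsExpWeights.coupled {Ω : Type*} [MeasurableSpace Ω] {P : Measure Ω} {ρ : ℝ}
    {X : ℕ × ℕ → Ω → ℝ} (h : IsExpWeights (1 - ρ) ρ P X) (hρ0 : 0 < ρ) (hρ1 : ρ < 1)
    {z w : ℝ} (hz1 : z < 1) (hw0 : 0 < w) :
    IsExpWeights (1 - z) w P (fun x ω =>
      CornerGrowth.scaleBoundary ((1 - ρ) / (1 - z)) (ρ / w) (fun y => X y ω) x) := by
  have h1 : 0 < 1 - ρ := by linarith
  have h2 : 0 < 1 - z := by linarith
  have := h.scaleBoundary h1 hρ0 (div_pos h1 h2) (div_pos hρ0 hw0)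
  rwa [div_div_cancel₀ h1.ne', div_div_cancel₀ hρ0.ne'] at this

/-! ### Second-moment bounds at the scale `s`. -/

section

variable {Ω : Type*} [MeasurableSpace Ω] {P : Measure Ω} [IsProbabilityMeasure P] {ρ : ℝ}
  {X : ℕ × ℕ → Ω → ℝ}

theorem integrable_exp_coupledLpp (h : IsExpWeights (1 - ρ) ρ P X) (hρ0 : 0 < ρ) (hρ1 : ρ < 1)
    {z w : ℝ} (hz0 : 0 < z) (hz1 : z < 1) (hw0 : 0 < w) (hw1 : w < 1) (m n : ℕ) (c : ℝ) :
    Integrable (fun ω => Real.exp ((w - z) * (coupledLpp ρ X m n z w ω - c))) P := by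
  have := ((h.coupled hρ0 hρ1 hz1 hw0).integrable_exp_lpp hz0 hz1 hw0 hw1 m n).mul_const
    (Real.exp (-((w - z) * c)))
  simp only [← Real.exp_add, ← sub_eq_add_neg, ← mul_sub] at this
  exact this

theorem integral_exp_coupledLpp (h : IsExpWeights (1 - ρ) ρ P X) (hρ0 : 0 < ρ) (hρ1 : ρ < 1)
    {z w : ℝ} (hz0 : 0 < z) (hz1 : z < 1) (hw0 : 0 < w) (hw1 : w < 1) (m n : ℕ) (c : ℝ) :
    ∫ ω, Real.exp ((w - z) * (coupledLpp ρ X m n z w ω - c)) ∂P =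
      Real.exp (logGrowth m n w - logGrowth m n z - (w - z) * c) := by
  have h1 := (h.coupled hρ0 hρ1 hz1 hw0).integral_exp_lpp hz0 hz1 hw0 hw1 m n
  rw [exp_logGrowth_sub hz0 hz1 hw0 hw1] at h1
  rw [Real.exp_sub _ ((w - z) * c), ← h1, ← integral_div]
  refine integral_congr_ae (Filter.Eventually.of_forall fun ω => ?_)
  simp only
  rw [← Real.exp_sub, ← mul_sub]
  rfl

/-- `s` is a scale, of order `((m + n) ^ (2 / 3) + |skew m n ρ|) ^ (-1 / 2)`, at which the exponential
moments of the centred last-passage value are bounded. -/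
structure IsMomentScale (ρ r s : ℝ) (m n : ℕ) : Prop where
  pos : 0 < r
  le_left : r ≤ ρ
  le_right : r ≤ 1 - ρ
  scale_pos : 0 < s
  scale_le : 6 * s ≤ r
  moment_le : 6 * s ^ 2 * |skew m n ρ| + 36 / r ^ 3 * s ^ 3 * (m + n) ≤ 1

variable {r s : ℝ} {m n : ℕ}

theorem IsMomentScale.integral_exp_le (hs : IsMomentScale ρ r s m n)
    (h : IsExpWeights (1 - ρ) ρ P X) {z w : ℝ} (hz : |z - ρ| ≤ 3 * s) (hw : |w - ρ| ≤ 3 * s)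
    (hzw : |w - z| ≤ 2 * s) :
    Integrable (fun ω => Real.exp ((w - z) * (coupledLpp ρ X m n z w ω - meanGrowth m n ρ))) P ∧
    ∫ ω, Real.exp ((w - z) * (coupledLpp ρ X m n z w ω - meanGrowth m n ρ)) ∂P ≤
      Real.exp 1 := by
  obtain ⟨hr, hr0, hr1, hs0, hsr, hm⟩ := hs
  have := abs_le.1 hz
  have := abs_le.1 hw
  refine ⟨integrable_exp_coupledLpp h (by linarith) (by linarith) (by linarith) (by linarith)
    (by linarith) (by linarith) m n _, ?_⟩
  rw [integral_exp_coupledLpp h (by linarith) (by linarith) (by linarith) (by linarith)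
    (by linarith) (by linarith)]
  refine Real.exp_le_exp.2 ?_
  refine (le_abs_self _).trans ((abs_logGrowth_sub_le m n hr hr0 hr1 (by linarith) hz hw).trans ?_)
  calc _ ≤ (3 * s * |skew m n ρ| + 2 / r ^ 3 * (3 * s) ^ 2 * (m + n)) * (2 * s) := by gcongr
    _ = 6 * s ^ 2 * |skew m n ρ| + 36 / r ^ 3 * s ^ 3 * (m + n) := by ring
    _ ≤ 1 := hm

theorem IsMomentScale.integral_exp_le_two (hs : IsMomentScale ρ r s m n)
    (h : IsExpWeights (1 - ρ) ρ P X) {z w t : ℝ} (ht0 : 0 ≤ t) (ht : t ≤ 2 * s)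
    (hz : |z - ρ| ≤ 3 * s) (hw : |w - ρ| ≤ 3 * s)
    (hz' : |z + t - ρ| ≤ 3 * s) (hw' : |w - t - ρ| ≤ 3 * s) :
    Integrable (fun ω => Real.exp (t * (coupledLpp ρ X m n z w ω - meanGrowth m n ρ))) P ∧
    ∫ ω, Real.exp (t * (coupledLpp ρ X m n z w ω - meanGrowth m n ρ)) ∂P ≤
      2 * Real.exp 1 := by
  obtain ⟨i1, e1⟩ := hs.integral_exp_le h (z := z) (w := z + t) hz hz'
    (by rw [abs_of_nonneg (by linarith)]; linarith)
  obtain ⟨i2, e2⟩ := hs.integral_exp_le h (z := w - t) (w := w) hw' hw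
    (by rw [abs_of_nonneg (by linarith)]; linarith)
  simp only [add_sub_cancel_left, sub_sub_cancel] at i1 e1 i2 e2
  have hle := fun ω => exp_coupledLpp_le ρ X m n z w (meanGrowth m n ρ) ht0 ω
  have hw1 := abs_le.1 hw
  have hz1 := abs_le.1 hz
  have hmeas : AEStronglyMeasurable
      (fun ω => Real.exp (t * (coupledLpp ρ X m n z w ω - meanGrowth m n ρ))) P := by
    have := (h.coupled (by linarith [hs.pos, hs.le_left]) (by linarith [hs.pos, hs.le_right])
      (z := z) (w := w) (by linarith [hs.le_right, hs.scale_le, hs.scale_pos])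
      (by linarith [hs.le_left, hs.scale_le, hs.scale_pos])).aemeasurable_lpp m n
    exact (Real.measurable_exp.comp_aemeasurable
      ((this.sub_const _).const_mul t)).aestronglyMeasurable
  have hint : Integrable
      (fun ω => Real.exp (t * (coupledLpp ρ X m n z w ω - meanGrowth m n ρ))) P :=
    (i1.add i2).mono' hmeas (Filter.Eventually.of_forall fun ω => by
      rw [Real.norm_eq_abs, abs_of_pos (Real.exp_pos _)]
      exact hle ω)
  refine ⟨hint, (integral_mono hint (i1.add i2) hle).trans ?_⟩
  rw [Pi.add_def, integral_add i1 i2]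
  linarith

/-- The right tail is controlled by `G` itself. The left tail uses the rate pair `(ρ, ρ - s)`, whose
negative exponential moment is exact, together with convexity to return to `(ρ, ρ)`. The total is `2
· 2e + 16 · e + 4 · 2e = 28 e`. -/
theorem IsMomentScale.integral_sq_le (hs : IsMomentScale ρ r s m n)
    (h : IsExpWeights (1 - ρ) ρ P X) :
    Integrable (fun ω => (lpp (fun x => X x ω) m n - meanGrowth m n ρ) ^ 2) P ∧
    s ^ 2 * ∫ ω, (lpp (fun x => X x ω) m n - meanGrowth m n ρ) ^ 2 ∂P ≤ 28 * Real.exp 1 := by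
  have hs0 := hs.scale_pos
  have hρ0 : 0 < ρ := by linarith [hs.pos, hs.le_left]
  have hρ1 : ρ < 1 := by linarith [hs.pos, hs.le_right]
  have hsρ : 6 * s ≤ ρ := hs.scale_le.trans hs.le_left
  -- Chosen so that the scale `ρ / (ρ - s)` is the midpoint of `1` and `ρ / w₂`. It satisfies `ρ - 2
  -- s ≤ w₂`, so `w₂ - s` remains within `3 s` of `ρ`.
  set w₂ := ρ * (ρ - s) / (ρ + s) with hw₂
  have hw₂' : ρ - w₂ = 2 * s * (ρ / (ρ + s)) := by
    rw [hw₂]; field_simp; ring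
  have hfrac1 : ρ / (ρ + s) ≤ 1 := by rw [div_le_one (by linarith)]; linarith
  have hfrac0 : 0 < ρ / (ρ + s) := by positivity
  have hw₂l : ρ - 2 * s ≤ w₂ := by nlinarith
  have hw₂u : w₂ ≤ ρ := by nlinarith
  obtain ⟨i0, e0⟩ := hs.integral_exp_le_two h (z := ρ) (w := ρ) (t := s) hs0.le (by linarith)
    (by simp [hs0.le]) (by simp [hs0.le]) (by rw [abs_le]; constructor <;> linarith)
    (by rw [abs_le]; constructor <;> linarith)
  obtain ⟨i1, e1⟩ := hs.integral_exp_le h (z := ρ) (w := ρ - s) (by simp [hs0.le])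
    (by rw [abs_le]; constructor <;> linarith) (by rw [abs_le]; constructor <;> linarith)
  obtain ⟨i2, e2⟩ := hs.integral_exp_le_two h (z := ρ) (w := w₂) (t := s) hs0.le (by linarith)
    (by simp [hs0.le]) (by rw [abs_le]; constructor <;> linarith)
    (by rw [abs_le]; constructor <;> linarith) (by rw [abs_le]; constructor <;> linarith)
  rw [sub_sub_cancel_left] at i1 e1
  simp only [coupledLpp_self hρ0 hρ1] at i0 e0
  have hconv : ∀ ω, 2 * coupledLpp ρ X m n ρ (ρ - s) ω ≤
      lpp (fun x => X x ω) m n + coupledLpp ρ X m n ρ w₂ ω := by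
    intro ω
    have := lpp_scaleBoundary_convex (fun x => X x ω) ((1 - ρ) / (1 - ρ)) 1 (ρ / w₂) m n
    have hv : (1 + ρ / w₂) / 2 = ρ / (ρ - s) := by
      have h1 : ρ - s ≠ 0 := by linarith
      have h2 : ρ + s ≠ 0 := by linarith
      rw [hw₂]; field_simp; ring
    rw [hv] at this
    refine this.trans (le_of_eq ?_)
    rw [coupledLpp, div_self (by linarith : 1 - ρ ≠ 0), scaleBoundary_one]
  have hle := fun ω => sq_le_of_convex (c := meanGrowth m n ρ) hs0 (hconv ω)
  have hmaj := ((i0.const_mul 2).add (i1.const_mul 16)).add (i2.const_mul 4)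
  have hmeas : AEStronglyMeasurable
      (fun ω => s ^ 2 * (lpp (fun x => X x ω) m n - meanGrowth m n ρ) ^ 2) P :=
    ((((h.aemeasurable_lpp m n).sub_const _).pow_const 2).const_mul _).aestronglyMeasurable
  have hint : Integrable
      (fun ω => s ^ 2 * (lpp (fun x => X x ω) m n - meanGrowth m n ρ) ^ 2) P :=
    hmaj.mono' hmeas (Filter.Eventually.of_forall fun ω => by
      rw [Real.norm_eq_abs, abs_of_nonneg (by positivity)]
      exact hle ω)
  refine ⟨(integrable_const_mul_iff (IsUnit.mk0 _ (by positivity)) _).1 hint, ?_⟩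
  rw [← integral_const_mul]
  refine (integral_mono hint hmaj hle).trans ?_
  have i01 : Integrable (fun ω =>
      2 * Real.exp (s * (lpp (fun x => X x ω) m n - meanGrowth m n ρ)) +
        16 * Real.exp (-s * (coupledLpp ρ X m n ρ (ρ - s) ω - meanGrowth m n ρ))) P :=
    (i0.const_mul 2).add (i1.const_mul 16)
  simp only [Pi.add_def]
  rw [integral_add i01 (i2.const_mul 4), integral_add (i0.const_mul 2) (i1.const_mul 16),
    integral_const_mul, integral_const_mul, integral_const_mul]
  linarith

theorem IsMomentScale.le_integral_exp (hs : IsMomentScale ρ r s m n)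
    (h : IsExpWeights (1 - ρ) ρ P X) :
    Integrable (fun ω => Real.exp (s * (lpp (fun x => X x ω) m n - meanGrowth m n ρ))) P ∧
    1 + (s ^ 2 * |skew m n ρ| / 2 + s ^ 3 * (m + n) / 3) ≤
      ∫ ω, Real.exp (s * (lpp (fun x => X x ω) m n - meanGrowth m n ρ)) ∂P := by
  have hs0 := hs.scale_pos
  have hρ0 : 0 < ρ := by linarith [hs.pos, hs.le_left]
  have hρ1 : ρ < 1 := by linarith [hs.pos, hs.le_right]
  have hsρ : 6 * s ≤ ρ := hs.scale_le.trans hs.le_left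
  have hsρ' : 6 * s ≤ 1 - ρ := hs.scale_le.trans hs.le_right
  obtain ⟨i0, -⟩ := hs.integral_exp_le_two h (z := ρ) (w := ρ) (t := s) hs0.le (by linarith)
    (by simp [hs0.le]) (by simp [hs0.le]) (by rw [abs_le]; constructor <;> linarith)
    (by rw [abs_le]; constructor <;> linarith)
  simp only [coupledLpp_self hρ0 hρ1] at i0
  refine ⟨i0, ?_⟩
  -- Taking `z ≤ ρ ≤ w` raises both boundary rates, hence lowers the coupled value, while its
  -- exponential moment at `s = w - z` is exact.
  have key : ∀ z w : ℝ, z ≤ ρ → ρ ≤ w → 0 < z → w < 1 → w - z = s →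
      s ^ 2 * |skew m n ρ| / 2 + s ^ 3 * (m + n) / 3 ≤
        logGrowth m n w - logGrowth m n z - s * meanGrowth m n ρ →
      1 + (s ^ 2 * |skew m n ρ| / 2 + s ^ 3 * (m + n) / 3) ≤
        ∫ ω, Real.exp (s * (lpp (fun x => X x ω) m n - meanGrowth m n ρ)) ∂P := by
    intro z w hz hw hz0 hw1 hwz hlog
    have i1 := integrable_exp_coupledLpp h hρ0 hρ1 hz0 (by linarith) (by linarith) hw1 m n
      (meanGrowth m n ρ)
    have e1 := integral_exp_coupledLpp h hρ0 hρ1 hz0 (by linarith) (by linarith) hw1 m n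
      (meanGrowth m n ρ)
    rw [hwz] at i1 e1
    have hexp := Real.add_one_le_exp
      (logGrowth m n w - logGrowth m n z - s * meanGrowth m n ρ)
    rw [← e1] at hexp
    have hmono : ∫ ω, Real.exp (s * (coupledLpp ρ X m n z w ω - meanGrowth m n ρ)) ∂P ≤
        ∫ ω, Real.exp (s * (lpp (fun x => X x ω) m n - meanGrowth m n ρ)) ∂P := by
      refine integral_mono_ae i1 i0 ?_
      filter_upwards [h.ae_nonneg] with ω hω
      have : coupledLpp ρ X m n z w ω ≤ lpp (fun x => X x ω) m n :=
        lpp_scaleBoundary_le ((div_le_one (by linarith)).2 (by linarith))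
          ((div_le_one (by linarith)).2 hw) hω m n
      gcongr
    linarith
  -- The sign of the skew decides which axis is perturbed, so that the quadratic term enters with a
  -- positive sign; the cubic term is positive either way.
  rcases le_total 0 (skew m n ρ) with hδ | hδ
  · refine key ρ (ρ + s) le_rfl (by linarith) hρ0 (by linarith) (by ring) ?_
    have := logGrowth_sub_ge m n hρ0 hρ1 hρ0 (by linarith : ρ ≤ ρ + s) (by linarith)
    rw [abs_of_nonneg hδ]
    simp only [add_sub_cancel_left, sub_self] at this
    linarith
  · refine key (ρ - s) ρ (by linarith) le_rfl (by linarith) hρ1 (by ring) ?_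
    have := logGrowth_sub_ge m n hρ0 hρ1 (by linarith) (by linarith : ρ - s ≤ ρ) (by linarith)
    rw [abs_of_nonpos hδ]
    simp only [sub_sub_cancel_left, sub_sub_cancel, sub_self] at this
    linarith

/-- Since the centred value `Z` has mean zero, `E (exp (s Z) - 1 - s Z)` is at least `c`. Only the
quadratic term can supply this once the part from large `Z` is made at most `c / 2`. -/
theorem IsMomentScale.integral_sq_ge (hs : IsMomentScale ρ r s m n)
    (h : IsExpWeights (1 - ρ) ρ P X) {c : ℝ} (hc0 : 0 < c) (hc1 : c ≤ 1)
    (hc : c ≤ s ^ 2 * |skew m n ρ| / 2 + s ^ 3 * (m + n) / 3) :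
    c ^ 2 / (8 * Real.exp 1) ≤
      s ^ 2 * ∫ ω, (lpp (fun x => X x ω) m n - meanGrowth m n ρ) ^ 2 ∂P := by
  have hs0 := hs.scale_pos
  have hρ0 : 0 < ρ := by linarith [hs.pos, hs.le_left]
  have hρ1 : ρ < 1 := by linarith [hs.pos, hs.le_right]
  obtain ⟨i1, e1⟩ := hs.le_integral_exp h
  obtain ⟨i2, e2⟩ := hs.integral_exp_le_two h (z := ρ) (w := ρ) (t := 2 * s) (by linarith) le_rfl
    (by simp [hs0.le]) (by simp [hs0.le]) (by rw [abs_le]; constructor <;> linarith)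
    (by rw [abs_le]; constructor <;> linarith)
  simp only [coupledLpp_self hρ0 hρ1] at i2 e2
  obtain ⟨isq, -⟩ := hs.integral_sq_le h
  have imean : ∫ ω, lpp (fun x => X x ω) m n ∂P = meanGrowth m n ρ :=
    h.integral_lpp (by linarith) hρ0 (by ring) m n
  have ic : Integrable (fun ω => lpp (fun x => X x ω) m n - meanGrowth m n ρ) P :=
    ((memLp_two_iff_integrable_sq
      ((h.aemeasurable_lpp m n).sub_const _).aestronglyMeasurable).2 isq).integrable one_le_two
  have il : Integrable (fun ω => lpp (fun x => X x ω) m n) P := by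
    refine (ic.add (integrable_const (meanGrowth m n ρ))).congr
      (Filter.Eventually.of_forall fun ω => ?_)
    simp
  set Z : Ω → ℝ := fun ω => lpp (fun x => X x ω) m n - meanGrowth m n ρ with hZ
  have iz : ∫ ω, Z ω ∂P = 0 := by
    rw [hZ, integral_sub il (integrable_const _), imean]
    simp
  set V := ∫ ω, Z ω ^ 2 ∂P with hV
  -- The truncation level is `M = log (4 e / c)`: with `E exp (2 s Z) ≤ 2 e`, the term with factor
  -- `exp (-M)` is then at most `c / 2`.
  have hE : 1 ≤ 4 * Real.exp 1 / c := by
    rw [le_div_iff₀ hc0]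
    nlinarith [Real.add_one_le_exp (1 : ℝ)]
  have hpt := fun ω => exp_sub_one_sub_le (Real.log_nonneg hE) (s * Z ω)
  have hpos : 0 < 4 * Real.exp 1 / c := by linarith
  simp only [Real.exp_neg, Real.exp_log hpos] at hpt
  have i11 : Integrable (fun ω => Real.exp (s * Z ω) - 1) P := i1.sub (integrable_const 1)
  have hL : ∫ ω, (Real.exp (s * Z ω) - 1 - s * Z ω) ∂P = ∫ ω, Real.exp (s * Z ω) ∂P - 1 := by
    rw [integral_sub i11 (ic.const_mul s),
      integral_sub i1 (integrable_const 1), integral_const_mul, iz]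
    simp [hZ]
  have i2' : Integrable (fun ω => Real.exp (2 * (s * Z ω))) P := by
    simpa only [mul_assoc] using i2
  have isq' : Integrable (fun ω => (s * Z ω) ^ 2) P := by
    simpa only [mul_pow] using isq.const_mul (s ^ 2)
  have hR := integral_mono (i11.sub (ic.const_mul s))
    ((isq'.const_mul (4 * Real.exp 1 / c)).add (i2'.const_mul (4 * Real.exp 1 / c)⁻¹)) hpt
  simp only [Pi.sub_def, Pi.add_def] at hR
  rw [hL, integral_add (isq'.const_mul _) (i2'.const_mul _), integral_const_mul,
    integral_const_mul] at hR
  have hV' : ∫ ω, (s * Z ω) ^ 2 ∂P = s ^ 2 * V := by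
    simp only [mul_pow]
    rw [integral_const_mul]
  have e2' : ∫ ω, Real.exp (2 * (s * Z ω)) ∂P ≤ 2 * Real.exp 1 := by
    simpa only [mul_assoc] using e2
  rw [hV'] at hR
  have h3 : (4 * Real.exp 1 / c)⁻¹ * ∫ ω, Real.exp (2 * (s * Z ω)) ∂P ≤ c / 2 := by
    calc _ ≤ (4 * Real.exp 1 / c)⁻¹ * (2 * Real.exp 1) := by gcongr
      _ = c / 2 := by
        rw [inv_div]
        have := (Real.exp_pos 1).ne'
        field_simp
        norm_num
  have h4 : c / 2 ≤ 4 * Real.exp 1 / c * (s ^ 2 * V) := by linarith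
  have hep := Real.exp_pos 1
  rw [div_mul_eq_mul_div, le_div_iff₀ hc0] at h4
  rw [div_le_iff₀ (by positivity)]
  linarith

end

/-! ### Choice of the scale and uniform variance bounds. -/

/-- The order `(m + n) ^ (2 / 3) + |skew m n ρ|` of the variance of the last-passage value. -/
noncomputable def varianceOrder (m n : ℕ) (ρ : ℝ) : ℝ :=
  ((m : ℝ) + n) ^ (2 / 3 : ℝ) + |skew m n ρ|

theorem one_le_varianceOrder {m n : ℕ} (hm : 1 ≤ m) (ρ : ℝ) : 1 ≤ varianceOrder m n ρ := by
  have h : (1 : ℝ) ≤ (m : ℝ) + n := by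
    have : (1 : ℝ) ≤ m := by exact_mod_cast hm
    have : (0 : ℝ) ≤ n := Nat.cast_nonneg n
    linarith
  have := Real.one_le_rpow h (by norm_num : (0 : ℝ) ≤ 2 / 3)
  unfold varianceOrder
  linarith [abs_nonneg (skew m n ρ)]

/-- Take `s = r / (8 √T)` with `T = varianceOrder m n ρ`. Then `(s Q)² + s² |skew| = r² / 64` with
`Q = (m + n)^{1/3}`, so both terms are bounded and at least one of them is bounded below. -/
theorem exists_momentScale {ρ r : ℝ} (hr : 0 < r) (hr0 : r ≤ ρ) (hr1 : r ≤ 1 - ρ) {m n : ℕ}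
    (hm : 1 ≤ m) : ∃ s, IsMomentScale ρ r s m n ∧ s ^ 2 * varianceOrder m n ρ = r ^ 2 / 64 ∧
      r ^ 3 / 5184 ≤ s ^ 2 * |skew m n ρ| / 2 + s ^ 3 * (m + n) / 3 := by
  set T := varianceOrder m n ρ with hT
  have hT1 : 1 ≤ T := one_le_varianceOrder hm ρ
  have hT0 : 0 < T := by linarith
  set Q := ((m : ℝ) + n) ^ (1 / 3 : ℝ) with hQ
  have hmn : (0 : ℝ) ≤ (m : ℝ) + n := by positivity
  have hQ0 : 0 ≤ Q := Real.rpow_nonneg hmn _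
  have hQ3 : Q ^ 3 = (m : ℝ) + n := by
    rw [hQ, ← Real.rpow_natCast, ← Real.rpow_mul hmn]
    norm_num
  have hTQ : T = Q ^ 2 + |skew m n ρ| := by
    rw [hT, varianceOrder, hQ, ← Real.rpow_natCast, ← Real.rpow_mul hmn]
    norm_num
  have hr2 : r ≤ 1 / 2 := by linarith
  have hsT : (r / 8 / Real.sqrt T) ^ 2 * T = r ^ 2 / 64 := by
    rw [div_pow, Real.sq_sqrt hT0.le]
    field_simp
    norm_num
  have hs0 : 0 < r / 8 / Real.sqrt T := by positivity
  have hs1 : r / 8 / Real.sqrt T ≤ r / 8 :=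
    div_le_self (by positivity) (Real.one_le_sqrt.2 hT1)
  generalize r / 8 / Real.sqrt T = s at hsT hs0 hs1
  have hδ := abs_nonneg (skew m n ρ)
  have hsQ0 : 0 ≤ s * Q := by positivity
  have hsum : (s * Q) ^ 2 + s ^ 2 * |skew m n ρ| = r ^ 2 / 64 := by
    rw [← hsT, hTQ]; ring
  have hsδ : 0 ≤ s ^ 2 * |skew m n ρ| := by positivity
  have hsQ : s * Q ≤ r / 8 := by
    refine le_of_sq_le_sq ?_ (by positivity)
    nlinarith
  have hsQ3 : s ^ 3 * (m + n) = (s * Q) ^ 3 := by rw [← hQ3]; ring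
  have hsQ3' : (s * Q) ^ 3 ≤ (r / 8) ^ 3 := pow_le_pow_left₀ hsQ0 hsQ 3
  refine ⟨s, ⟨hr, hr0, hr1, hs0, by linarith, ?_⟩, hsT, ?_⟩
  · have h1 : 36 / r ^ 3 * s ^ 3 * (m + n) ≤ 36 / 512 := by
      rw [mul_assoc, hsQ3]
      calc 36 / r ^ 3 * (s * Q) ^ 3 ≤ 36 / r ^ 3 * (r / 8) ^ 3 := by gcongr
        _ = 36 / 512 := by field_simp; norm_num
    have h2 : s ^ 2 * |skew m n ρ| ≤ r ^ 2 / 64 := by nlinarith [sq_nonneg (s * Q)]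
    have h3 : r ^ 2 ≤ 1 := by nlinarith
    linarith
  · rw [hsQ3]
    have hr23 : r ^ 3 ≤ r ^ 2 := pow_le_pow_of_le_one hr.le (by linarith) (by norm_num)
    have hQ3nn : 0 ≤ (s * Q) ^ 3 := by positivity
    -- If `s Q ≥ r / 12`, the cubic term alone gives `(r / 12)³ / 3 = r³ / 5184`; otherwise the skew
    -- term carries most of `r² / 64`.
    rcases le_total (r / 12) (s * Q) with h | h
    · have := pow_le_pow_left₀ (by positivity) h 3
      nlinarith
    · have := pow_le_pow_left₀ hsQ0 h 2
      nlinarith [sq_nonneg r]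

/-- The variance of the stationary last-passage value is of order
`(m + n) ^ (2 / 3) + |skew m n ρ|`, uniformly in `m` and `n`. -/
theorem exists_variance_bounds {ρ : ℝ} (hρ0 : 0 < ρ) (hρ1 : ρ < 1) : ∃ c C : ℝ, 0 < c ∧ 0 < C ∧
    ∀ {Ω : Type*} [MeasurableSpace Ω] (P : Measure Ω) [IsProbabilityMeasure P]
      (X : ℕ × ℕ → Ω → ℝ), IsStationaryWeights ρ P X → ∀ m n : ℕ, 1 ≤ m →
        MemLp (stationaryG X m n) 2 P ∧
        c * varianceOrder m n ρ ≤ variance (stationaryG X m n) P ∧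
        variance (stationaryG X m n) P ≤ C * varianceOrder m n ρ := by
  set r := min ρ (1 - ρ) with hr
  have hr0 : 0 < r := lt_min hρ0 (by linarith)
  have he := Real.exp_pos 1
  -- The factor `64 / r ^ 2` converts `s⁻²` into `varianceOrder` through `s² T = r² / 64`.
  refine ⟨(r ^ 3 / 5184) ^ 2 / (8 * Real.exp 1) * (64 / r ^ 2), 28 * Real.exp 1 * (64 / r ^ 2),
    by positivity, by positivity, ?_⟩
  intro Ω _ P _ X hX m n hm
  have h := hX.isExpWeights
  obtain ⟨s, hs, hsT, hc⟩ := exists_momentScale hr0 (min_le_left _ _) (min_le_right _ _)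
    (n := n) hm
  have hG : stationaryG X m n = fun ω => lpp (fun x => X x ω) m n := by
    funext ω
    exact boundaryLastPassage_eq_lpp _ m n
  have hr1 : r ≤ 1 := (min_le_left _ _).trans hρ1.le
  have hr3 : r ^ 3 ≤ 1 := pow_le_one₀ hr0.le hr1
  obtain ⟨isq, hup⟩ := hs.integral_sq_le h
  have hlow := hs.integral_sq_ge h (by positivity) (by linarith) hc
  have hvar : variance (stationaryG X m n) P =
      ∫ ω, (lpp (fun x => X x ω) m n - meanGrowth m n ρ) ^ 2 ∂P := by
    rw [hG, variance_eq_integral (h.aemeasurable_lpp m n),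
      h.integral_lpp (by linarith) hρ0 (by ring) m n]
    rfl
  have hmem : MemLp (stationaryG X m n) 2 P := by
    have h1 := ((memLp_two_iff_integrable_sq
      ((h.aemeasurable_lpp m n).sub_const _).aestronglyMeasurable).2 isq).add
      (memLp_const (meanGrowth m n ρ))
    rw [hG]
    refine h1.ae_eq (Filter.Eventually.of_forall fun ω => ?_)
    simp
  refine ⟨hmem, ?_, ?_⟩
  all_goals
    rw [hvar]
    generalize ∫ ω, (lpp (fun x => X x ω) m n - meanGrowth m n ρ) ^ 2 ∂P = V at *
    have hT : varianceOrder m n ρ = r ^ 2 / 64 / s ^ 2 := by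
      rw [eq_div_iff (pow_pos hs.scale_pos 2).ne', mul_comm, hsT]
    have hs2 : 0 < s ^ 2 := pow_pos hs.scale_pos 2
  · calc _ = (r ^ 3 / 5184) ^ 2 / (8 * Real.exp 1) / s ^ 2 := by rw [hT]; field_simp
      _ ≤ V := by rw [div_le_iff₀ hs2]; linarith
  · calc V ≤ 28 * Real.exp 1 / s ^ 2 := by rw [le_div_iff₀ hs2]; linarith
      _ = _ := by rw [hT]; field_simp

/-! ### Comparison with `N^{2/3}` near the characteristic direction. -/

/-- The skew vanishes at the characteristic point and is linear in `(m, n)`, so it is at most of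
order `a₀ N^{2/3}`; the sum `m + n` is at most `N (1 + 2 a₀)`. -/
theorem varianceOrder_le {ρ r : ℝ} (hr : 0 < r) (hr0 : r ≤ ρ) (hr1 : r ≤ 1 - ρ) {a₀ N : ℝ}
    (ha : 0 < a₀) (hN : 1 ≤ N) {m n : ℕ}
    (h : charDeviation ρ N m n ≤ a₀ * N ^ (2 / 3 : ℝ)) :
    varianceOrder m n ρ ≤ (2 / r ^ 2 + 2) * (1 + a₀) * N ^ (2 / 3 : ℝ) := by
  have hN0 : 0 < N := by linarith
  set S := N ^ (2 / 3 : ℝ) with hS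
  have hS1 : 1 ≤ S := Real.one_le_rpow hN (by norm_num)
  have hSN : S ≤ N := by
    simpa using Real.rpow_le_rpow_of_exponent_le hN (by norm_num : (2 / 3 : ℝ) ≤ 1)
  have h1 : |(m : ℝ) - N * (1 - ρ) ^ 2| ≤ a₀ * S := (le_max_left _ _).trans h
  have h2 : |(n : ℝ) - N * ρ ^ 2| ≤ a₀ * S := (le_max_right _ _).trans h
  have hρ0 : 0 < ρ := by linarith
  have hρ1 : 0 < 1 - ρ := by linarith
  have hskew : |skew m n ρ| ≤ 2 / r ^ 2 * (a₀ * S) := by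
    have e : skew m n ρ = (m - N * (1 - ρ) ^ 2) / (1 - ρ) ^ 2 - (n - N * ρ ^ 2) / ρ ^ 2 := by
      unfold skew; field_simp; ring
    rw [e]
    refine (abs_sub _ _).trans ?_
    rw [abs_div, abs_div, abs_of_pos (by positivity : 0 < (1 - ρ) ^ 2),
      abs_of_pos (by positivity : 0 < ρ ^ 2)]
    calc _ ≤ a₀ * S / r ^ 2 + a₀ * S / r ^ 2 := by gcongr
      _ = _ := by ring
  have hmn : (m : ℝ) + n ≤ N * (1 + 2 * a₀) := by
    have := (abs_le.1 h1).2
    have := (abs_le.1 h2).2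
    have h3 : N * ((1 - ρ) ^ 2 + ρ ^ 2) ≤ N * 1 := by
      gcongr
      nlinarith
    have h4 : a₀ * S ≤ a₀ * N := by gcongr
    linarith
  have hpow : ((m : ℝ) + n) ^ (2 / 3 : ℝ) ≤ S * (1 + 2 * a₀) := by
    calc ((m : ℝ) + n) ^ (2 / 3 : ℝ) ≤ (N * (1 + 2 * a₀)) ^ (2 / 3 : ℝ) := by gcongr
      _ = S * (1 + 2 * a₀) ^ (2 / 3 : ℝ) := Real.mul_rpow hN0.le (by positivity)
      _ ≤ S * (1 + 2 * a₀) := by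
        gcongr
        simpa using Real.rpow_le_rpow_of_exponent_le (by linarith : 1 ≤ 1 + 2 * a₀)
          (by norm_num : (2 / 3 : ℝ) ≤ 1)
  have hK : 0 ≤ 2 / r ^ 2 * S := by positivity
  unfold varianceOrder
  linarith

theorem le_varianceOrder {ρ r : ℝ} (hr : 0 < r) (hr0 : r ≤ ρ) (hr1 : r ≤ 1 - ρ) {a₀ N : ℝ}
    (ha : 0 < a₀) (hN : 1 ≤ N) {m n : ℕ} (hm : 1 ≤ m)
    (h : charDeviation ρ N m n ≤ a₀ * N ^ (2 / 3 : ℝ)) :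
    r ^ 4 / 4 * Real.exp (-1 * a₀ ^ 3) * N ^ (2 / 3 : ℝ) ≤ varianceOrder m n ρ := by
  have hN0 : 0 < N := by linarith
  set q := N ^ (1 / 3 : ℝ) with hq
  have hq1 : 1 ≤ q := Real.one_le_rpow hN (by norm_num)
  have hq3 : q ^ 3 = N := by
    rw [hq, ← Real.rpow_natCast, ← Real.rpow_mul hN0.le]; norm_num
  have hq2 : N ^ (2 / 3 : ℝ) = q ^ 2 := by
    rw [hq, ← Real.rpow_natCast, ← Real.rpow_mul hN0.le]; norm_num
  rw [hq2] at h ⊢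
  have h1 : |(m : ℝ) - N * (1 - ρ) ^ 2| ≤ a₀ * q ^ 2 := (le_max_left _ _).trans h
  have hr2 : r ≤ 1 / 2 := by linarith
  have hexp : Real.exp (-1 * a₀ ^ 3) ≤ 1 := Real.exp_le_one_iff.2 (by
    have : 0 < a₀ ^ 3 := by positivity
    linarith)
  -- For `a₀` small against `N^{1/3}` the deviation cannot destroy the order of `m`, so `m + n` is
  -- of order `N`. Otherwise `N^{2/3}` is at most a multiple of `a₀²`, which `exp (a₀³)` absorbs,
  -- and the trivial bound `1 ≤ varianceOrder` suffices.
  rcases le_total (2 * a₀) (r ^ 2 * q) with ha' | ha'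
  · have hmN : r ^ 2 / 2 * N ≤ (m : ℝ) + n := by
      have h2 := (abs_le.1 h1).1
      have h3 : r ^ 2 ≤ (1 - ρ) ^ 2 := by gcongr
      have h4 : N * r ^ 2 ≤ N * (1 - ρ) ^ 2 := by gcongr
      have h5 : 2 * a₀ * q ^ 2 ≤ r ^ 2 * q * q ^ 2 := by gcongr
      have h6 : r ^ 2 * q * q ^ 2 = r ^ 2 * N := by rw [← hq3]; ring
      have : (0 : ℝ) ≤ n := Nat.cast_nonneg n
      linarith
    have h7 : r ^ 2 / 2 * q ^ 2 ≤ ((m : ℝ) + n) ^ (2 / 3 : ℝ) := by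
      calc r ^ 2 / 2 * q ^ 2 ≤ (r ^ 2 / 2) ^ (2 / 3 : ℝ) * q ^ 2 := by
            gcongr
            have := Real.rpow_le_rpow_of_exponent_ge (x := r ^ 2 / 2) (by positivity)
              (by nlinarith) (by norm_num : (2 / 3 : ℝ) ≤ 1)
            simpa using this
        _ = (r ^ 2 / 2 * N) ^ (2 / 3 : ℝ) := by
            rw [Real.mul_rpow (by positivity) hN0.le, hq2]
        _ ≤ _ := by gcongr
    have h8 : r ^ 4 / 4 * Real.exp (-1 * a₀ ^ 3) ≤ r ^ 2 / 2 := by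
      have : r ^ 4 ≤ r ^ 2 := pow_le_pow_of_le_one hr.le (by linarith) (by norm_num)
      have h9 : r ^ 4 / 4 * Real.exp (-1 * a₀ ^ 3) ≤ r ^ 4 / 4 * 1 := by gcongr
      nlinarith [sq_nonneg r]
    have h10 := mul_le_mul_of_nonneg_right h8 (sq_nonneg q)
    unfold varianceOrder
    linarith [abs_nonneg (skew m n ρ)]
  · refine le_trans ?_ (one_le_varianceOrder hm ρ)
    have h2 : (r ^ 2 * q) ^ 2 ≤ (2 * a₀) ^ 2 := by gcongr
    have h3 : a₀ ^ 2 ≤ Real.exp (a₀ ^ 3) := by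
      have := Real.add_one_le_exp (a₀ ^ 3)
      rcases le_total a₀ 1 with h | h
      · have : a₀ ^ 2 ≤ 1 := pow_le_one₀ ha.le h
        have : 0 < a₀ ^ 3 := by positivity
        linarith
      · have : a₀ ^ 2 ≤ a₀ ^ 3 := pow_le_pow_right₀ h (by norm_num)
        linarith
    have h4 : r ^ 4 / 4 * q ^ 2 ≤ Real.exp (a₀ ^ 3) := by nlinarith
    calc r ^ 4 / 4 * Real.exp (-1 * a₀ ^ 3) * q ^ 2
        = r ^ 4 / 4 * q ^ 2 * Real.exp (-1 * a₀ ^ 3) := by ring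
      _ ≤ Real.exp (a₀ ^ 3) * Real.exp (-1 * a₀ ^ 3) := by gcongr
      _ = 1 := by rw [← Real.exp_add]; simp

end CornerGrowth

theorem mainTheorem2 (ρ : ℝ) (hρ0 : 0 < ρ) (hρ1 : ρ < 1) :
    (∀ a₀ : ℝ, 0 < a₀ → ∃ C : ℝ, 0 < C ∧
      ∀ (Ω : Type*) [MeasurableSpace Ω] (P : Measure Ω) [IsProbabilityMeasure P]
        (w : ℕ × ℕ → Ω → ℝ), CornerGrowth.IsStationaryWeights ρ P w →
        ∀ (N : ℝ) (m n : ℕ), 1 ≤ N → 1 ≤ m → 1 ≤ n →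
          CornerGrowth.charDeviation ρ N m n ≤ a₀ * N ^ (2 / 3 : ℝ) →
          MemLp (CornerGrowth.stationaryG w m n) 2 P ∧
          C⁻¹ * N ^ (2 / 3 : ℝ) ≤ variance (CornerGrowth.stationaryG w m n) P ∧
          variance (CornerGrowth.stationaryG w m n) P ≤ C * N ^ (2 / 3 : ℝ)) ∧
    (∃ c₁ C₂ C₃ : ℝ, 0 < c₁ ∧ 0 < C₂ ∧ 0 < C₃ ∧
      ∀ a₀ : ℝ, 0 < a₀ →
      ∀ (Ω : Type*) [MeasurableSpace Ω] (P : Measure Ω) [IsProbabilityMeasure P]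
        (w : ℕ × ℕ → Ω → ℝ), CornerGrowth.IsStationaryWeights ρ P w →
        ∀ (N : ℝ) (m n : ℕ), 1 ≤ N → 1 ≤ m → 1 ≤ n →
          CornerGrowth.charDeviation ρ N m n ≤ a₀ * N ^ (2 / 3 : ℝ) →
          c₁ * Real.exp (-C₂ * a₀ ^ 3) * N ^ (2 / 3 : ℝ)
            ≤ variance (CornerGrowth.stationaryG w m n) P ∧
          variance (CornerGrowth.stationaryG w m n) P
            ≤ C₃ * (1 + a₀) * N ^ (2 / 3 : ℝ)) := by
  set r := min ρ (1 - ρ)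
  have hr : 0 < r := lt_min hρ0 (by linarith)
  have hr0 : r ≤ ρ := min_le_left _ _
  have hr1 : r ≤ 1 - ρ := min_le_right _ _
  refine ⟨fun a₀ ha => ?_, ?_⟩
  · obtain ⟨c, C, hc, hC, h⟩ := CornerGrowth.exists_variance_bounds hρ0 hρ1
    set L := c * (r ^ 4 / 4 * Real.exp (-1 * a₀ ^ 3)) with hL
    set U := C * ((2 / r ^ 2 + 2) * (1 + a₀)) with hU
    have hL0 : 0 < L := by positivity
    have hU0 : 0 < U := by positivity
    refine ⟨max L⁻¹ U, lt_max_of_lt_right hU0, ?_⟩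
    intro Ω _ P _ w hw N m n hN hm hn hκ
    obtain ⟨h0, h1, h2⟩ := h P w hw m n hm
    have hN0 : 0 ≤ N ^ (2 / 3 : ℝ) := by positivity
    refine ⟨h0, le_trans ?_ h1, h2.trans ?_⟩
    · calc (max L⁻¹ U)⁻¹ * N ^ (2 / 3 : ℝ) ≤ L * N ^ (2 / 3 : ℝ) := by
            gcongr
            exact inv_le_of_inv_le₀ hL0 (le_max_left _ _)
        _ = c * (r ^ 4 / 4 * Real.exp (-1 * a₀ ^ 3) * N ^ (2 / 3 : ℝ)) := by rw [hL]; ring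
        _ ≤ _ := by
            gcongr
            exact CornerGrowth.le_varianceOrder hr hr0 hr1 ha hN hm hκ
    · calc C * CornerGrowth.varianceOrder m n ρ ≤
            C * ((2 / r ^ 2 + 2) * (1 + a₀) * N ^ (2 / 3 : ℝ)) := by
            gcongr
            exact CornerGrowth.varianceOrder_le hr hr0 hr1 ha hN hκ
        _ = U * N ^ (2 / 3 : ℝ) := by rw [hU]; ring
        _ ≤ _ := by
            gcongr
            exact le_max_right _ _
  · obtain ⟨c, C, hc, hC, h⟩ := CornerGrowth.exists_variance_bounds hρ0 hρ1
    refine ⟨c * (r ^ 4 / 4), 1, C * (2 / r ^ 2 + 2), by positivity, one_pos, by positivity, ?_⟩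
    intro a₀ ha Ω _ P _ w hw N m n hN hm hn hκ
    obtain ⟨-, h1, h2⟩ := h P w hw m n hm
    refine ⟨le_trans ?_ h1, h2.trans ?_⟩
    · rw [mul_assoc c, mul_assoc c]
      gcongr
      exact CornerGrowth.le_varianceOrder hr hr0 hr1 ha hN hm hκ
    · rw [mul_assoc C, mul_assoc C]
      gcongr
      exact CornerGrowth.varianceOrder_le hr hr0 hr1 ha hN hκ
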